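/- Let $p,q\ge 0$ be integers and consider the multiple component chirp-like model $$y(t)=\sum_{j=1}^{p}\{A_j^0\cos(\alpha_j^0t)+B_j^0\sin(\alpha_j^0t)\}+\sum_{k=1}^{q}\{C_k^0\cos(\beta_k^0t^2)+D_k^0\sin(\beta_k^0t^2)\}+X(t),\qquad t=1,\dots,n.$$ Write $\theta_j^{0(1)}=(A_j^0,B_j^0,\alpha_j^0)$ and $\theta_k^{0(2)}=(C_k^0,D_k^0,\beta_k^0)$. Assume: 1. $X(t)=\sum_{j=-\infty}^{\infty}a(j)e(t-j)$, where $\{e(t)\}_{t\in\mathbb Z}$ are i.i.d. random variables with mean $0$ and finite variance $\sigma^2$, and the $a(j)$ are real constants with $\sum_j|a(j)|<\infty$. 2. Every $\theta_j^{0(1)}$ and every $\theta_k^{0(2)}$ is an interior point of $\Theta_1=[-M,M]\times[-M,M]\times[0,\pi]$; the $\alpha_j^0$ are distinct and the $\beta_k^0$ are distinct. 3. ${A_1^0}^2+{B_1^0}^2>\dots>{A_p^0}^2+{B_p^0}^2>0$ and ${C_1^0}^2+{D_1^0}^2>\dots>{C_q^0}^2+{D_q^0}^2>0$. 4. The frequency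 rates avoid the following exceptional values: no $\beta_k^0$, and no $\beta_k^0\pm\beta_l^0$ with $k\ne l$, is a rational multiple of $\pi$. The sequential least squares estimators based on $y(1),\dots,y(n)$ are defined as follows. For $j=1,\dots,p$, $\tilde\theta_j^{(1)}=(\tilde A_j,\tilde B_j,\tilde\alpha_j)$ minimises $$\sum_{t=1}^n\bigl(y_{j-1}(t)-A\cos(\alpha t)-B\sin(\alpha t)\bigr)^2,\qquad y_0=y,\quad y_j(t)=y_{j-1}(t)-\tilde A_j\cos(\tilde\alpha_jt)-\tilde B_j\sin(\tilde\alpha_jt);$$ then, for $k=1,\dots,q$, $\tilde\theta_k^{(2)}=(\tilde C_k,\tilde D_k,\tilde\beta_k)$ minimises $$\sum_{t=1}^n\bigl(y_{p+k-1}(t)-C\cos(\beta t^2)-D\sin(\beta t^2)\bigr)^2,\qquad y_{p+k}(t)=y_{p+k-1}(t)-\tilde C_k\cos(\tilde\beta_kt^2)-\tilde D_k\sin(\tilde\beta_kt^2).$$ All these minimisations are over the same set, which is either $\Theta_1$ or $\mathbb R\times\mathbb R\times[0,\pi]$ (amplitudes by unrestricted linear regression). Suppose that, almost surely, for all sufficiently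 large $n$ the estimators are such minimisers. Then, whichever of the two sets is used and whichever minimisers are chosen, (a) $\tilde\theta_j^{(1)}\to\theta_j^{0(1)}$ almost surely as $n\to\infty$, for all $j=2,\dots,p$; (b) $\tilde\theta_k^{(2)}\to\theta_k^{0(2)}$ almost surely as $n\to\infty$, for all $k=2,\dots,q$. -/

import Mathlib

open MeasureTheory ProbabilityTheory Filter Topology

noncomputable section

namespace ChirpLike

/-- Parameters of one component: cosine amplitude, sine amplitude, and frequency (for a sinusoid)
or frequency rate (for a chirp). -/
abbrev Param : Type := ℝ × ℝ × ℝ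

/-- `A cos(α t) + B sin(α t)` for `θ = (A, B, α)`. -/
def sinusoid (θ : Param) (t : ℕ) : ℝ :=
  θ.1 * Real.cos (θ.2.2 * t) + θ.2.1 * Real.sin (θ.2.2 * t)

/-- `C cos(β t²) + D sin(β t²)` for `θ = (C, D, β)`. -/
def chirp (θ : Param) (t : ℕ) : ℝ :=
  θ.1 * Real.cos (θ.2.2 * (t : ℝ) ^ 2) + θ.2.1 * Real.sin (θ.2.2 * (t : ℝ) ^ 2)

/-- The squared amplitude of a component. -/
def power (θ : Param) : ℝ := θ.1 ^ 2 + θ.2.1 ^ 2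

/-- The parameter space `[-M, M] × [-M, M] × [0, π]` of one component. -/
def paramSpace (M : ℝ) : Set Param :=
  Set.Icc (-M) M ×ˢ Set.Icc (-M) M ×ˢ Set.Icc 0 Real.pi

/-- `ℝ × ℝ × [0, π]`: the amplitudes are unrestricted, so that minimising a sum of squares over
this set means linear regression on the amplitudes followed by minimisation over `[0, π]`. -/
def freeAmplitudeSpace : Set Param :=
  Set.univ ×ˢ Set.univ ×ˢ Set.Icc 0 Real.pi

/-- `X` is the linear process `X(t) = ∑_{j ∈ ℤ} a(j) e(t - j)` with i.i.d. innovations `e` of mean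
zero and finite variance `σ²`, and absolutely summable real coefficients `a`. -/
structure IsLinearProcess {Ω : Type*} [MeasurableSpace Ω] (μ : Measure Ω)
    (e : ℤ → Ω → ℝ) (a : ℤ → ℝ) (σ : ℝ) (X : ℤ → Ω → ℝ) : Prop where
  measurable : ∀ t, Measurable (e t)
  indep : iIndepFun e μ
  identDistrib : ∀ s t, IdentDistrib (e s) (e t) μ μ
  memLp : ∀ t, MemLp (e t) 2 μ
  mean : ∀ t, ∫ ω, e t ω ∂μ = 0
  variance : ∀ t, variance (e t) μ = σ ^ 2
  summable : Summable fun j => |a j|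
  hasSum : ∀ t, ∀ᵐ ω ∂μ, HasSum (fun j => a j * e (t - j) ω) (X t ω)

/-- The observations `y(t)`: `p` sinusoids plus `q` chirps plus noise. -/
def signal {Ω : Type*} {p q : ℕ} (θ₁ : Fin p → Param) (θ₂ : Fin q → Param)
    (X : ℤ → Ω → ℝ) (ω : Ω) (t : ℕ) : ℝ :=
  ∑ j, sinusoid (θ₁ j) t + ∑ k, chirp (θ₂ k) t + X t ω

/-- The error sum of squares `∑_{t=1}^n (z(t) - f(θ, t))²` of data `z`. -/
def errorSS (f : Param → ℕ → ℝ) (n : ℕ) (z : ℕ → ℝ) (θ : Param) : ℝ :=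
  ∑ t ∈ Finset.Icc 1 n, (z t - f θ t) ^ 2

/-- `θ` minimises the error sum of squares over `S`. -/
def IsLSE (S : Set Param) (f : Param → ℕ → ℝ) (n : ℕ) (z : ℕ → ℝ) (θ : Param) : Prop :=
  θ ∈ S ∧ IsMinOn (errorSS f n z) S θ

/-- The data left after the first `j` estimated sinusoids have been removed. -/
def sinusoidResidual {p : ℕ} (y : ℕ → ℝ) (θ₁ : Fin p → Param) (j : Fin p) (t : ℕ) : ℝ :=
  y t - ∑ i ∈ Finset.Iio j, sinusoid (θ₁ i) t

/-- The data left after all estimated sinusoids and the first `k` estimated chirps have been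
removed. -/
def chirpResidual {p q : ℕ} (y : ℕ → ℝ) (θ₁ : Fin p → Param) (θ₂ : Fin q → Param)
    (k : Fin q) (t : ℕ) : ℝ :=
  y t - ∑ i, sinusoid (θ₁ i) t - ∑ i ∈ Finset.Iio k, chirp (θ₂ i) t

/-- `(θ₁, θ₂)` is an output of the sequential least squares procedure on `y(1), …, y(n)`: the
sinusoids are fitted one at a time, each to the residual left by the previous ones, and then the
chirps are fitted one at a time in the same way. -/
structure IsSequentialLSE (S : Set Param) {p q : ℕ} (n : ℕ) (y : ℕ → ℝ)
    (θ₁ : Fin p → Param) (θ₂ : Fin q → Param) : Prop where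
  sinusoid_step : ∀ j, IsLSE S sinusoid n (sinusoidResidual y θ₁ j) (θ₁ j)
  chirp_step : ∀ k, IsLSE S chirp n (chirpResidual y θ₁ θ₂ k) (θ₂ k)

/-- The components are interior points of the parameter space and their frequencies (or frequency
rates) are distinct. -/
structure IsInteriorDistinct {m : ℕ} (M : ℝ) (θ : Fin m → Param) : Prop where
  interior : ∀ j, θ j ∈ interior (paramSpace M)
  distinct : Function.Injective fun j => (θ j).2.2

/-- The squared amplitudes are strictly decreasing and positive. -/
structure HasDecreasingPower {m : ℕ} (θ : Fin m → Param) : Prop where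
  strictAnti : StrictAnti fun j => power (θ j)
  pos : ∀ j, 0 < power (θ j)

/-- The frequency rates, and the sums and differences of two of them, avoid the countable set of
rational multiples of `π`, on which the mean values of `exp(i φ t²)`, or of its products with
`exp(i α t)`, need not vanish. -/
structure HasGenericRates {m : ℕ} (θ : Fin m → Param) : Prop where
  rate : ∀ k, Irrational ((θ k).2.2 / Real.pi)
  add : ∀ k l, k ≠ l → Irrational (((θ k).2.2 + (θ l).2.2) / Real.pi)
  sub : ∀ k l, k ≠ l → Irrational (((θ k).2.2 - (θ l).2.2) / Real.pi)

end ChirpLike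

end

/-! Fix a path of the noise. Everything rests on averages over t = 1, …, n of exp(i φ_n t^d), d = 1,
2, alone or weighted by the noise. They are controlled along arbitrary sequences φ_n, which is what
makes the bounds uniform in the frequency.

Noise. By van der Corput's lemma (`tendsto_avg_of_correlations`) averages vanish when the
correlations of distinct translates do. Two applications remove a quadratic phase and leave sample
moments of order two and four of the innovations, which the strong law supplies
(`ae_isUncorrelated`). In those products the earliest innovation occurs only once, so finite
variance is enough. The linear process follows by dominated convergence over its coefficients, with
a maximal bound for the averages of |e| (`ae_tendsto_avg_linearProcess`).

Uniformity in the fit. Near the frequencies 0 and π the sine part of a component almost disappears,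
so a component of moderate size can have huge amplitudes. Errors are therefore measured relative to
the root mean square of the component (`Negligible`). For the key inequality `abs_avg_mul_comp_le`
there are two cases. If the average of exp(2iφt^d) is away from modulus one, the root mean square
controls the amplitudes. Otherwise a rigidity statement (`abs_mul_pow_le_waveDev`) puts φ within
O(n^{-d}) of 0 or π; up to the sign (-1)^t the component varies slowly, and summation by parts
applies.

Consistency (`tendsto_lse`). Least squares maximises the gain 2⟨z, g⟩ - |g|² of the fitted component
g. Along an ultrafilter the fitted frequency converges, and at most one true component resonates
with the limit; the gain is asymptotically at most half the power of that one. The strongest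
component attains half of the largest power, so it is the resonant one, and the fit approaches it in
mean square. For chirps resonance is weaker than equality, and rigidity is used again: closeness in
mean square forces a frequency error o(n^{-d}), and then the amplitudes converge
(`tendsto_of_tendsto_rms_sub`).

A component fitted well in mean square leaves a negligible error when subtracted, which drives the
induction (`tendsto_sequential`). In the sinusoid stage the chirps are negligible by Weyl's
estimate; in the chirp stage the sinusoids are already removed. -/

namespace ChirpLike

open ComplexConjugate

/-! ### Averages over 1, …, n. -/

section Averages

variable {E : Type*} [NormedAddCommGroup E] [NormedSpace ℝ E]

/-- The average of `F` over `1, …, n`. -/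
noncomputable def avg (n : ℕ) (F : ℕ → E) : E := (n : ℝ)⁻¹ • ∑ t ∈ Finset.Icc 1 n, F t

lemma avg_add (n : ℕ) (F G : ℕ → E) : avg n (fun t => F t + G t) = avg n F + avg n G := by
  simp [avg, Finset.sum_add_distrib]

lemma avg_sub (n : ℕ) (F G : ℕ → E) : avg n (fun t => F t - G t) = avg n F - avg n G := by
  simp [avg, Finset.sum_sub_distrib, smul_sub]

lemma avg_sum {ι : Type*} (s : Finset ι) (n : ℕ) (F : ι → ℕ → E) :
    avg n (fun t => ∑ i ∈ s, F i t) = ∑ i ∈ s, avg n (F i) := by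
  simp only [avg]
  rw [Finset.sum_comm, Finset.smul_sum]

lemma avg_const_mul {R : Type*} [NormedRing R] [NormedAlgebra ℝ R] (n : ℕ) (c : R) (F : ℕ → R) :
    avg n (fun t => c * F t) = c * avg n F := by
  simp [avg, Finset.mul_sum]

lemma avg_const {n : ℕ} (hn : n ≠ 0) (c : E) : avg n (fun _ => c) = c := by
  have : (n : ℝ) ≠ 0 := by exact_mod_cast hn
  simp only [avg, Finset.sum_const, Nat.card_Icc, Nat.add_sub_cancel]
  rw [← Nat.cast_smul_eq_nsmul ℝ, smul_smul, inv_mul_cancel₀ this, one_smul]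

lemma norm_avg_le (n : ℕ) (F : ℕ → E) : ‖avg n F‖ ≤ avg n (fun t => ‖F t‖) := by
  simp only [avg, norm_smul, norm_inv, Real.norm_natCast, smul_eq_mul]
  gcongr
  exact norm_sum_le _ _

lemma avg_mono {n : ℕ} {F G : ℕ → ℝ} (h : ∀ t ∈ Finset.Icc 1 n, F t ≤ G t) :
    avg n F ≤ avg n G := by
  simp only [avg, smul_eq_mul]
  gcongr with t ht
  exact h t ht

lemma avg_nonneg {n : ℕ} {F : ℕ → ℝ} (h : ∀ t, 0 ≤ F t) : 0 ≤ avg n F := by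
  simp only [avg, smul_eq_mul]
  exact mul_nonneg (by positivity) (Finset.sum_nonneg fun t _ => h t)

lemma avg_le_const {n : ℕ} {F : ℕ → ℝ} {c : ℝ} (hc : 0 ≤ c) (h : ∀ t, F t ≤ c) :
    avg n F ≤ c := by
  rcases eq_or_ne n 0 with rfl | hn
  · simpa [avg] using hc
  · calc avg n F ≤ avg n (fun _ => c) := avg_mono fun t _ => h t
      _ = c := avg_const hn c

lemma reCLM_avg (n : ℕ) (F : ℕ → ℂ) : (avg n F).re = avg n (fun t => (F t).re) := by
  simp [avg]

/-- Cauchy–Schwarz for averages. -/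
lemma abs_avg_mul_le (n : ℕ) (F G : ℕ → ℝ) :
    |avg n (fun t => F t * G t)| ≤
      √(avg n (fun t => F t ^ 2)) * √(avg n (fun t => G t ^ 2)) := by
  rw [← Real.sqrt_mul (avg_nonneg fun t => sq_nonneg _)]
  apply Real.abs_le_sqrt
  simp only [avg, smul_eq_mul]
  have := Finset.sum_mul_sq_le_sq_mul_sq (Finset.Icc 1 n) F G
  calc ((n : ℝ)⁻¹ * ∑ t ∈ Finset.Icc 1 n, F t * G t) ^ 2
      = ((n : ℝ)⁻¹) ^ 2 * (∑ t ∈ Finset.Icc 1 n, F t * G t) ^ 2 := by ring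
    _ ≤ ((n : ℝ)⁻¹) ^ 2 * ((∑ t ∈ Finset.Icc 1 n, F t ^ 2) * ∑ t ∈ Finset.Icc 1 n, G t ^ 2) := by
        gcongr
    _ = _ := by ring

lemma norm_avg_sq_le (n : ℕ) (F : ℕ → E) : ‖avg n F‖ ^ 2 ≤ avg n (fun t => ‖F t‖ ^ 2) := by
  rcases eq_or_ne n 0 with rfl | hn
  · simp [avg]
  have h := abs_avg_mul_le n (fun t => ‖F t‖) (fun _ => 1)
  have h1 : avg n (fun _ : ℕ => (1 : ℝ) ^ 2) = 1 := by simpa using avg_const hn (1 : ℝ)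
  rw [h1] at h
  simp only [mul_one, Real.sqrt_one] at h
  have h2 : ‖avg n F‖ ≤ √(avg n (fun t => ‖F t‖ ^ 2)) :=
    (norm_avg_le n F).trans ((le_abs_self _).trans h)
  calc ‖avg n F‖ ^ 2 ≤ (√(avg n (fun t => ‖F t‖ ^ 2))) ^ 2 := by gcongr
    _ = _ := Real.sq_sqrt (avg_nonneg fun t => sq_nonneg _)

end Averages

lemma sum_Icc_shift_sub {E : Type*} [AddCommGroup E] (g : ℕ → E) (n : ℕ) :
    ∑ t ∈ Finset.Icc 1 n, g (t + 1) - ∑ t ∈ Finset.Icc 1 n, g t = g (n + 1) - g 1 := by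
  induction n with
  | zero => simp
  | succ n ih =>
    rw [Finset.sum_Icc_succ_top (by omega), Finset.sum_Icc_succ_top (by omega)]
    rw [← sub_eq_zero] at ih ⊢
    rw [← ih]
    abel

/-! ### Van der Corput's lemma. -/

section VanDerCorput

/-- A shift by one changes the average only by one term at each end, and since ∑ v² ≤ C n a single
term is O(√n). -/
lemma tendsto_avg_shift_sub {l : Filter ℕ} (hl : l ≤ atTop) {x : ℕ → ℕ → ℂ} {v : ℕ → ℝ} {C : ℝ}
    (hxv : ∀ n t, ‖x n t‖ ≤ v t) (hv : ∀ n : ℕ, ∑ t ∈ Finset.Icc 1 n, v t ^ 2 ≤ C * n) (h : ℕ) :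
    Tendsto (fun n => avg n (fun t => x n (t + h)) - avg n (x n)) l (𝓝 0) := by
  have hv0 : ∀ t, 0 ≤ v t := fun t => (norm_nonneg _).trans (hxv 0 t)
  have hC : 0 ≤ C := by
    have := hv 1
    simp only [Finset.Icc_self, Finset.sum_singleton, Nat.cast_one, mul_one] at this
    exact (sq_nonneg _).trans this
  have hvt : ∀ t : ℕ, 1 ≤ t → v t ≤ √(C * t) := by
    intro t ht
    apply Real.le_sqrt_of_sq_le
    refine le_trans ?_ (hv t)
    exact Finset.single_le_sum (f := fun t => v t ^ 2) (fun i _ => sq_nonneg _)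
      (Finset.mem_Icc.2 ⟨ht, le_rfl⟩)
  induction h with
  | zero => simpa using tendsto_const_nhds
  | succ h ih =>
    have key : Tendsto (fun n => avg n (fun t => x n (t + (h + 1))) - avg n (fun t => x n (t + h)))
        l (𝓝 0) := by
      have hb : ∀ n : ℕ, ‖avg n (fun t => x n (t + (h + 1))) - avg n (fun t => x n (t + h))‖ ≤
          (n : ℝ)⁻¹ * (√(C * (n + h + 1 : ℕ)) + v (1 + h)) := by
        intro n
        have e : avg n (fun t => x n (t + (h + 1))) - avg n (fun t => x n (t + h)) =
            (n : ℝ)⁻¹ • (x n (n + 1 + h) - x n (1 + h)) := by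
          simp only [avg]
          rw [← smul_sub]
          congr 1
          rw [← sum_Icc_shift_sub (fun t => x n (t + h)) n]
          congr 2
          ext t
          congr 1
          ring
        rw [e, norm_smul, norm_inv, Real.norm_natCast]
        gcongr
        refine (norm_sub_le _ _).trans (add_le_add ((hxv _ _).trans ?_) (hxv _ _))
        have := hvt (n + 1 + h) (by omega)
        rwa [show n + 1 + h = n + h + 1 by ring] at this ⊢
      have hlim : Tendsto (fun n : ℕ => (n : ℝ)⁻¹ * (√(C * (n + h + 1 : ℕ)) + v (1 + h)))
          atTop (𝓝 0) := by
        have h1 : Tendsto (fun n : ℕ => √(C * ((n : ℝ)⁻¹ + (h + 1) * ((n : ℝ)⁻¹ * (n : ℝ)⁻¹))) +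
            (n : ℝ)⁻¹ * v (1 + h)) atTop (𝓝 (√(C * (0 + (h + 1) * (0 * 0))) + 0 * v (1 + h))) := by
          have := tendsto_inv_atTop_nhds_zero_nat (𝕜 := ℝ)
          exact ((Real.continuous_sqrt.tendsto _).comp
            ((this.add ((this.mul this).const_mul _)).const_mul C)).add (this.mul_const _)
        simp only [mul_zero, add_zero, Real.sqrt_zero, zero_mul] at h1
        refine h1.congr' ?_
        filter_upwards [eventually_gt_atTop 0] with n hn
        have hn' : (0 : ℝ) < n := by exact_mod_cast hn
        rw [mul_add (n : ℝ)⁻¹ (√_)]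
        congr 1
        rw [show C * ((n : ℝ)⁻¹ + (h + 1) * ((n : ℝ)⁻¹ * (n : ℝ)⁻¹)) =
          ((n : ℝ)⁻¹) ^ 2 * (C * (n + h + 1 : ℕ)) by push_cast; field_simp; ring]
        rw [Real.sqrt_mul (by positivity), Real.sqrt_sq (by positivity)]
      exact squeeze_zero_norm hb (hlim.mono_left hl)
    have := key.add ih
    simp only [add_zero] at this
    refine this.congr fun n => ?_
    ring

/-- The van der Corput lemma: if the distinct translates of a triangular array of complex numbers
that is bounded in mean square are asymptotically uncorrelated, then its averages tend to zero. -/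
theorem tendsto_avg_of_correlations {l : Filter ℕ} (hl : l ≤ atTop) {x : ℕ → ℕ → ℂ} {v : ℕ → ℝ}
    {C : ℝ} (hxv : ∀ n t, ‖x n t‖ ≤ v t) (hv : ∀ n : ℕ, ∑ t ∈ Finset.Icc 1 n, v t ^ 2 ≤ C * n)
    (hcorr : ∀ h k, h ≠ k →
      Tendsto (fun n => avg n (fun t => x n (t + h) * conj (x n (t + k)))) l (𝓝 0)) :
    Tendsto (fun n => avg n (x n)) l (𝓝 0) := by
  have hC : 0 ≤ C := by
    have := hv 1
    simp only [Finset.Icc_self, Finset.sum_singleton, Nat.cast_one, mul_one] at this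
    exact (sq_nonneg _).trans this
  rw [Metric.tendsto_nhds]
  intro ε hε
  -- If the average has norm at least ε, near orthogonality of H translates gives (εH - 1)² ≤ 2CH +
  -- 1; this H makes that impossible.
  obtain ⟨H, hH⟩ := exists_nat_gt ((2 * C + 2 * ε) / ε ^ 2)
  have hH' : 2 * C + 2 * ε < ε ^ 2 * H := by
    rw [div_lt_iff₀ (by positivity)] at hH
    linarith
  have hD : ∀ᶠ n in l, ∑ h ∈ Finset.range H,
      ‖avg n (fun t => x n (t + h)) - avg n (x n)‖ < 1 := by
    have : Tendsto (fun n => ∑ h ∈ Finset.range H,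
        ‖avg n (fun t => x n (t + h)) - avg n (x n)‖) l (𝓝 (∑ h ∈ Finset.range H, 0)) :=
      tendsto_finsetSum _ fun h _ => by
        simpa using (tendsto_avg_shift_sub hl hxv hv h).norm
    simp only [Finset.sum_const_zero] at this
    exact this.eventually (gt_mem_nhds one_pos)
  have hO : ∀ᶠ n in l, ∑ h ∈ Finset.range H, ∑ k ∈ Finset.range H,
      (if h = k then 0 else ‖avg n (fun t => x n (t + h) * conj (x n (t + k)))‖) < 1 := by
    have : Tendsto (fun n => ∑ h ∈ Finset.range H, ∑ k ∈ Finset.range H,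
        (if h = k then 0 else ‖avg n (fun t => x n (t + h) * conj (x n (t + k)))‖)) l
        (𝓝 (∑ h ∈ Finset.range H, ∑ k ∈ Finset.range H, 0)) := by
      refine tendsto_finsetSum _ fun h _ => tendsto_finsetSum _ fun k _ => ?_
      by_cases hk : h = k
      · simpa [hk] using tendsto_const_nhds
      · simpa [hk] using (hcorr h k hk).norm
    simp only [Finset.sum_const_zero] at this
    exact this.eventually (gt_mem_nhds one_pos)
  filter_upwards [hD, hO, hl (eventually_ge_atTop H), hl (eventually_gt_atTop 0)]
    with n hD hO hnH hn0
  have hn0' : (0 : ℝ) < n := by exact_mod_cast hn0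
  have hnH' : (H : ℝ) ≤ n := by exact_mod_cast hnH
  -- As h < H ≤ n, the shifted window lies in 1, …, 2n, whence the factor 2.
  have hdiag : ∀ h ∈ Finset.range H, avg n (fun t => ‖x n (t + h)‖ ^ 2) ≤ 2 * C := by
    intro h hh
    have hh' : (h : ℝ) ≤ n := by
      have := Finset.mem_range.1 hh
      exact_mod_cast (by omega : h ≤ n)
    have e1 : ∑ t ∈ Finset.Icc 1 n, ‖x n (t + h)‖ ^ 2 ≤ C * (n + h : ℕ) := by
      refine le_trans ?_ (hv (n + h))
      calc ∑ t ∈ Finset.Icc 1 n, ‖x n (t + h)‖ ^ 2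
          ≤ ∑ t ∈ Finset.Icc 1 n, v (t + h) ^ 2 := by
            gcongr with t ht; exact hxv _ _
        _ = ∑ t ∈ (Finset.Icc 1 n).map (addRightEmbedding h), v t ^ 2 := by
            rw [Finset.sum_map]; rfl
        _ ≤ _ := by
            refine Finset.sum_le_sum_of_subset_of_nonneg ?_ fun i _ _ => sq_nonneg _
            rw [Finset.map_add_right_Icc]
            exact Finset.Icc_subset_Icc (by omega) le_rfl
    simp only [avg, smul_eq_mul]
    rw [inv_mul_le_iff₀ hn0']
    refine e1.trans ?_
    push_cast
    nlinarith
  have hsq : ‖avg n (fun t => ∑ h ∈ Finset.range H, x n (t + h))‖ ^ 2 ≤ H * (2 * C) + 1 := by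
    refine (norm_avg_sq_le _ _).trans ?_
    have e : ∀ t, ‖∑ h ∈ Finset.range H, x n (t + h)‖ ^ 2 =
        ∑ h ∈ Finset.range H, ∑ k ∈ Finset.range H, (x n (t + h) * conj (x n (t + k))).re := by
      intro t
      rw [← Complex.normSq_eq_norm_sq, ← Complex.ofReal_re (Complex.normSq _),
        ← Complex.mul_conj, map_sum, Finset.sum_mul_sum]
      simp only [Complex.re_sum]
    simp only [e]
    rw [avg_sum]
    calc ∑ h ∈ Finset.range H, avg n (fun t => ∑ k ∈ Finset.range H,
          (x n (t + h) * conj (x n (t + k))).re)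
        ≤ ∑ h ∈ Finset.range H, (2 * C + ∑ k ∈ Finset.range H,
          (if h = k then 0 else ‖avg n (fun t => x n (t + h) * conj (x n (t + k)))‖)) := by
          refine Finset.sum_le_sum fun h hh => ?_
          rw [avg_sum]
          calc ∑ k ∈ Finset.range H, avg n (fun t => (x n (t + h) * conj (x n (t + k))).re)
              ≤ ∑ k ∈ Finset.range H, ((if h = k then 2 * C else 0) +
                (if h = k then 0 else ‖avg n (fun t => x n (t + h) * conj (x n (t + k)))‖)) := by
                refine Finset.sum_le_sum fun k hk => ?_
                by_cases hhk : h = k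
                · subst hhk
                  simp only [if_true, add_zero]
                  refine le_trans (le_of_eq ?_) (hdiag h hh)
                  congr 1
                  ext t
                  rw [Complex.mul_conj, Complex.ofReal_re, Complex.normSq_eq_norm_sq]
                · simp only [hhk, if_false, zero_add]
                  rw [← reCLM_avg]
                  exact Complex.re_le_norm _
            _ = _ := by
                rw [Finset.sum_add_distrib]
                congr 1
                rw [Finset.sum_ite_eq]
                simp [hh]
      _ = H * (2 * C) + ∑ h ∈ Finset.range H, ∑ k ∈ Finset.range H,
          (if h = k then 0 else ‖avg n (fun t => x n (t + h) * conj (x n (t + k)))‖) := by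
          rw [Finset.sum_add_distrib]
          simp
      _ ≤ _ := by linarith
  rw [dist_zero_right]
  have hmain : H * ‖avg n (x n)‖ ≤ ‖avg n (fun t => ∑ h ∈ Finset.range H, x n (t + h))‖ + 1 := by
    have e : (H : ℂ) * avg n (x n) = avg n (fun t => ∑ h ∈ Finset.range H, x n (t + h)) -
        ∑ h ∈ Finset.range H, (avg n (fun t => x n (t + h)) - avg n (x n)) := by
      rw [avg_sum, Finset.sum_sub_distrib]
      simp
    calc H * ‖avg n (x n)‖ = ‖(H : ℂ) * avg n (x n)‖ := by simp
      _ ≤ _ := by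
        rw [e]
        refine (norm_sub_le _ _).trans ?_
        gcongr
        exact (norm_sum_le _ _).trans hD.le
  by_contra hcon
  push Not at hcon
  have hεH : 2 < ε * H := by
    have : 2 * ε < ε * (ε * H) := by nlinarith
    nlinarith
  have h1 : ε * H - 1 ≤ ‖avg n (fun t => ∑ h ∈ Finset.range H, x n (t + h))‖ := by
    have : ε * H ≤ H * ‖avg n (x n)‖ := by
      rw [mul_comm]; gcongr
    linarith
  have h2 : (ε * H - 1) ^ 2 ≤ H * (2 * C) + 1 := by
    refine le_trans ?_ hsq
    gcongr
    linarith
  have hHpos : (0 : ℝ) < H := by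
    by_contra h0
    push Not at h0
    nlinarith
  nlinarith

end VanDerCorput

/-! ### Unimodular numbers and waves. -/

section Waves

/-- `exp(i r)`. -/
noncomputable def cis (r : ℝ) : ℂ := Complex.exp (r * Complex.I)

lemma cis_add (r s : ℝ) : cis (r + s) = cis r * cis s := by
  simp [cis, add_mul, Complex.exp_add]

@[simp] lemma norm_cis (r : ℝ) : ‖cis r‖ = 1 := Complex.norm_exp_ofReal_mul_I r

@[simp] lemma cis_zero : cis 0 = 1 := by simp [cis]

lemma conj_cis (r : ℝ) : conj (cis r) = cis (-r) := by
  simp [cis, ← Complex.exp_conj]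

lemma cis_nat_mul (k : ℕ) (r : ℝ) : cis (k * r) = cis r ^ k := by
  simp [cis, ← Complex.exp_nat_mul, mul_assoc]

lemma continuous_cis : Continuous cis := by
  unfold cis; fun_prop

lemma cis_eq_one_iff (r : ℝ) : cis r = 1 ↔ ∃ k : ℤ, r = k * (2 * Real.pi) := by
  rw [cis, Complex.exp_eq_one_iff]
  refine exists_congr fun k => ?_
  constructor
  · intro h
    have := congrArg Complex.im h
    simpa using this
  · rintro rfl
    push_cast
    ring

lemma re_cis (r : ℝ) : (cis r).re = Real.cos r := Complex.exp_ofReal_mul_I_re r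

lemma im_cis (r : ℝ) : (cis r).im = Real.sin r := Complex.exp_ofReal_mul_I_im r

lemma norm_cis_sub_one (r : ℝ) : ‖cis r - 1‖ = 2 * |Real.sin (r / 2)| := by
  rw [cis, mul_comm, Complex.norm_exp_I_mul_ofReal_sub_one]
  simp

lemma norm_cis_sub_one_le (r : ℝ) : ‖cis r - 1‖ ≤ |r| := by
  rw [norm_cis_sub_one]
  have := Real.abs_sin_le_abs (x := r / 2)
  rw [abs_div, abs_two] at this
  linarith

lemma abs_le_of_norm_cis_sub_one {r : ℝ} (hr : |r| ≤ Real.pi) :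
    |r| ≤ Real.pi / 2 * ‖cis r - 1‖ := by
  rw [norm_cis_sub_one]
  have h := Real.mul_abs_le_abs_sin (x := r / 2) (by rw [abs_div, abs_two]; linarith)
  rw [abs_div, abs_two] at h
  have hpi := Real.pi_pos
  have : |r| = Real.pi * (2 / Real.pi * (|r| / 2)) := by field_simp
  rw [this]
  calc _ ≤ Real.pi * |Real.sin (r / 2)| := by gcongr
    _ = _ := by ring

/-- A discrete continuity argument. -/
lemma nat_mul_abs_le_of_norm_cis {N : ℕ} {r δ : ℝ} (hr : |r| ≤ Real.pi) (hδ : 0 ≤ δ) (hδ1 : δ ≤ 1)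
    (h : ∀ k ≤ N, ‖cis (k * r) - 1‖ ≤ δ) : N * |r| ≤ Real.pi / 2 * δ := by
  have hpi := Real.pi_pos
  suffices ∀ k ≤ N, k * |r| ≤ Real.pi / 2 * δ from this N le_rfl
  intro k
  induction k with
  | zero => intro _; simp; positivity
  | succ k ih =>
    intro hk
    have ih := ih (by omega)
    -- The multiples of r cannot jump over π: k|r| ≤ π/2 by induction, and for k ≥ 1 one more step
    -- at most doubles it.
    have hle : |((k + 1 : ℕ) : ℝ) * r| ≤ Real.pi := by
      rw [abs_mul, Nat.abs_cast]
      rcases Nat.eq_zero_or_pos k with rfl | hk0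
      · simpa using hr
      · have : (1 : ℝ) ≤ k := by exact_mod_cast hk0
        have h0 := abs_nonneg r
        push_cast
        nlinarith
    have := abs_le_of_norm_cis_sub_one hle
    rw [abs_mul, Nat.abs_cast] at this
    refine this.trans ?_
    gcongr
    exact h _ hk

/-- The complex wave `exp(i φ t ^ d)`. -/
noncomputable def wave (d : ℕ) (φ : ℝ) (t : ℕ) : ℂ := cis (φ * (t : ℝ) ^ d)

@[simp] lemma norm_wave (d : ℕ) (φ : ℝ) (t : ℕ) : ‖wave d φ t‖ = 1 := norm_cis _

lemma wave_add (d : ℕ) (φ ψ : ℝ) (t : ℕ) : wave d (φ + ψ) t = wave d φ t * wave d ψ t := by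
  simp [wave, add_mul, cis_add]

lemma conj_wave (d : ℕ) (φ : ℝ) (t : ℕ) : conj (wave d φ t) = wave d (-φ) t := by
  simp [wave, conj_cis]

lemma norm_avg_wave_le (d : ℕ) (φ : ℝ) (n : ℕ) : ‖avg n (wave d φ)‖ ≤ 1 :=
  (norm_avg_le _ _).trans (avg_le_const zero_le_one fun t => by simp)

lemma wave_two_pi (d : ℕ) (t : ℕ) : wave d (2 * Real.pi) t = 1 := by
  rw [wave, cis_eq_one_iff]
  exact ⟨(t : ℤ) ^ d, by push_cast; ring⟩

end Waves

/-! ### Exponential sums away from resonance. -/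

section Nonresonance

lemma norm_sum_pow_le {z : ℂ} (hz : ‖z‖ = 1) (n : ℕ) :
    ‖∑ t ∈ Finset.Icc 1 n, z ^ t‖ * ‖z - 1‖ ≤ 2 := by
  rw [← norm_mul]
  have e : (∑ t ∈ Finset.Icc 1 n, z ^ t) * (z - 1) = z ^ (n + 1) - z ^ 1 := by
    rw [← sum_Icc_shift_sub (fun t => z ^ t), mul_sub, mul_one, Finset.sum_mul]
    simp [pow_succ]
  rw [e]
  refine (norm_sub_le _ _).trans ?_
  simp [hz]
  norm_num

/-- Geometric sums have modulus at most 2/|z - 1|. The base may move with n, so its limit has to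
differ from 1. -/
lemma tendsto_avg_pow {l : Filter ℕ} (hl : l ≤ atTop) {z : ℕ → ℂ} {w : ℂ} (hz : ∀ n, ‖z n‖ = 1)
    (hzw : Tendsto z l (𝓝 w)) (hw : w ≠ 1) :
    Tendsto (fun n => avg n (fun t => z n ^ t)) l (𝓝 0) := by
  have hw' : ‖w - 1‖ ≠ 0 := norm_ne_zero_iff.2 (sub_ne_zero.2 hw)
  have h1 : Tendsto (fun n => ‖z n - 1‖) l (𝓝 ‖w - 1‖) := (hzw.sub_const 1).norm
  have h2 : Tendsto (fun n : ℕ => (n : ℝ)⁻¹ * (2 * ‖z n - 1‖⁻¹)) l (𝓝 (0 * (2 * ‖w - 1‖⁻¹))) :=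
    (tendsto_inv_atTop_nhds_zero_nat.mono_left hl).mul ((h1.inv₀ hw').const_mul 2)
  rw [zero_mul] at h2
  refine squeeze_zero_norm' ?_ h2
  filter_upwards [h1.eventually_ne hw'] with n hn
  have hn' : 0 < ‖z n - 1‖ := lt_of_le_of_ne (norm_nonneg _) (Ne.symm hn)
  rw [avg, norm_smul, norm_inv, Real.norm_natCast]
  gcongr
  rw [← div_eq_mul_inv, le_div_iff₀ hn']
  exact norm_sum_pow_le (hz n) n

/-- Weyl: quadratic exponential sums are small, uniformly in the linear term, if the leading
coefficient tends to a number that is no rational multiple of `π`. -/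
theorem tendsto_avg_quadratic {l : Filter ℕ} (hl : l ≤ atTop) {φ : ℕ → ℝ} {φ₀ : ℝ} (α : ℕ → ℝ)
    (hφ : Tendsto φ l (𝓝 φ₀)) (h₀ : Irrational (φ₀ / Real.pi)) :
    Tendsto (fun n => avg n (fun t => cis (φ n * (t : ℝ) ^ 2 + α n * t))) l (𝓝 0) := by
  refine tendsto_avg_of_correlations (x := fun n t => cis (φ n * (t : ℝ) ^ 2 + α n * t)) (C := 1)
    hl (v := fun _ => 1) (fun n t => by simp) (fun n => by simp) ?_
  intro h k hhk
  -- Differencing leaves a linear phase of slope 2(h - k)φ_n; the arbitrary linear term α_n survives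
  -- only in a factor independent of t.
  have e : ∀ n t : ℕ, cis (φ n * ((t + h : ℕ) : ℝ) ^ 2 + α n * (t + h : ℕ)) *
      conj (cis (φ n * ((t + k : ℕ) : ℝ) ^ 2 + α n * (t + k : ℕ))) =
      cis (φ n * ((h : ℝ) ^ 2 - (k : ℝ) ^ 2) + α n * (h - k)) *
        cis (2 * ((h : ℝ) - k) * φ n) ^ t := by
    intro n t
    rw [conj_cis, ← cis_add, ← cis_nat_mul, ← cis_add]
    congr 1
    push_cast
    ring
  simp only [e, avg_const_mul]
  have hw : cis (2 * ((h : ℝ) - k) * φ₀) ≠ 1 := by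
    rw [Ne, cis_eq_one_iff]
    rintro ⟨j, hj⟩
    have hhk' : (h : ℝ) - k ≠ 0 := by
      rw [sub_ne_zero]; exact_mod_cast hhk
    apply h₀
    refine ⟨(j : ℚ) / ((h : ℚ) - k), ?_⟩
    push_cast
    have hpi := Real.pi_ne_zero
    field_simp
    linarith
  have h1 := tendsto_avg_pow hl (z := fun n => cis (2 * ((h : ℝ) - k) * φ n)) (fun n => norm_cis _)
    ((continuous_cis.tendsto _).comp (hφ.const_mul _)) hw
  rw [tendsto_zero_iff_norm_tendsto_zero] at h1 ⊢
  simpa using h1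

lemma tendsto_avg_linear {l : Filter ℕ} (hl : l ≤ atTop) {φ : ℕ → ℝ} {φ₀ : ℝ}
    (hφ : Tendsto φ l (𝓝 φ₀)) (h₀ : cis φ₀ ≠ 1) :
    Tendsto (fun n => avg n (wave 1 (φ n))) l (𝓝 0) := by
  have h1 := tendsto_avg_pow hl (z := fun n => cis (φ n)) (fun n => norm_cis _)
    ((continuous_cis.tendsto _).comp hφ) h₀
  refine h1.congr fun n => ?_
  congr 1
  ext t
  rw [wave, ← cis_nat_mul, pow_one, mul_comm]

end Nonresonance

/-! ### Rigidity of waves whose average has modulus near one. -/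

section Rigidity

/-- The root mean square distance of the unimodular numbers `exp(i φ t ^ d)` from their average. -/
noncomputable def waveDev (d : ℕ) (φ : ℝ) (n : ℕ) : ℝ := √(1 - ‖avg n (wave d φ)‖ ^ 2)

lemma waveDev_nonneg (d : ℕ) (φ : ℝ) (n : ℕ) : 0 ≤ waveDev d φ n := Real.sqrt_nonneg _

lemma avg_dist_wave_le (d : ℕ) (φ : ℝ) {n : ℕ} (hn : n ≠ 0) :
    avg n (fun t => ‖wave d φ t - avg n (wave d φ)‖) ≤ waveDev d φ n := by
  set E := avg n (wave d φ) with hE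
  have h1 := norm_avg_sq_le n (fun t => ‖wave d φ t - E‖)
  -- Unimodular numbers with mean E have mean square distance 1 - |E|² from it.
  have h2 : avg n (fun t => ‖‖wave d φ t - E‖‖ ^ 2) = 1 - ‖E‖ ^ 2 := by
    have e : ∀ t, ‖‖wave d φ t - E‖‖ ^ 2 = 1 + ‖E‖ ^ 2 - 2 * (conj E * wave d φ t).re := by
      intro t
      rw [norm_norm, ← Complex.normSq_eq_norm_sq, Complex.normSq_sub, Complex.normSq_eq_norm_sq,
        Complex.normSq_eq_norm_sq, norm_wave]
      rw [mul_comm (conj E)]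
      ring
    simp only [e]
    rw [avg_sub, avg_const hn, avg_const_mul, ← reCLM_avg, avg_const_mul, ← hE, mul_comm (conj E),
      Complex.mul_conj, Complex.ofReal_re, Complex.normSq_eq_norm_sq]
    ring
  rw [h2] at h1
  refine (le_abs_self _).trans ?_
  rw [← Real.norm_eq_abs]
  exact Real.le_sqrt_of_sq_le h1

lemma sum_comp_affine_le {D : ℕ → ℝ} (hD : ∀ t, 0 ≤ D t) {a b m n : ℕ} (ha : a ≠ 0)
    (hmn : a * m + b ≤ n) :
    ∑ t ∈ Finset.Icc 1 m, D (a * t + b) ≤ ∑ t ∈ Finset.Icc 1 n, D t := by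
  have hinj : Set.InjOn (fun t => a * t + b) (Finset.Icc 1 m : Set ℕ) := by
    intro s _ t _ h
    simpa [ha] using h
  rw [← Finset.sum_image (f := D) hinj]
  refine Finset.sum_le_sum_of_subset_of_nonneg ?_ fun i _ _ => hD i
  intro s hs
  obtain ⟨t, ht, rfl⟩ := Finset.mem_image.1 hs
  rw [Finset.mem_Icc] at ht ⊢
  have h1 : a * t ≤ a * m := Nat.mul_le_mul_left a ht.2
  have h2 : 1 ≤ a * t := Nat.one_le_iff_ne_zero.2 (Nat.mul_ne_zero ha (by omega))
  omega

/-- On average the wave is near one constant E along both affine substitutions, which are injective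
and stay inside 1, …, n; hence the two values are near each other. -/
lemma sum_wave_sub_wave_le (d : ℕ) (φ : ℝ) {a b a' b' m n : ℕ} (hn : n ≠ 0) (ha : a ≠ 0)
    (ha' : a' ≠ 0) (h : a * m + b ≤ n) (h' : a' * m + b' ≤ n) :
    ∑ t ∈ Finset.Icc 1 m, ‖wave d φ (a * t + b) - wave d φ (a' * t + b')‖ ≤
      2 * n * waveDev d φ n := by
  set E := avg n (wave d φ) with hE
  have hn' : (0 : ℝ) < n := by exact_mod_cast Nat.pos_of_ne_zero hn
  have hsum : ∑ t ∈ Finset.Icc 1 n, ‖wave d φ t - E‖ ≤ n * waveDev d φ n := by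
    have := avg_dist_wave_le d φ hn
    rwa [avg, smul_eq_mul, inv_mul_le_iff₀ hn'] at this
  calc ∑ t ∈ Finset.Icc 1 m, ‖wave d φ (a * t + b) - wave d φ (a' * t + b')‖
      ≤ ∑ t ∈ Finset.Icc 1 m, (‖wave d φ (a * t + b) - E‖ + ‖wave d φ (a' * t + b') - E‖) := by
        gcongr with t ht
        rw [norm_sub_rev (wave d φ (a' * t + b'))]
        exact norm_sub_le_norm_sub_add_norm_sub _ _ _
    _ = ∑ t ∈ Finset.Icc 1 m, ‖wave d φ (a * t + b) - E‖ +
        ∑ t ∈ Finset.Icc 1 m, ‖wave d φ (a' * t + b') - E‖ := Finset.sum_add_distrib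
    _ ≤ _ := by
        have h1 := sum_comp_affine_le (D := fun t => ‖wave d φ t - E‖) (fun t => norm_nonneg _) ha h
        have h2 := sum_comp_affine_le (D := fun t => ‖wave d φ t - E‖) (fun t => norm_nonneg _)
          ha' h'
        linarith

lemma norm_mul_sub_one_le {z w : ℂ} (hz : ‖z‖ = 1) : ‖z * w - 1‖ ≤ ‖z - 1‖ + ‖w - 1‖ := by
  calc ‖z * w - 1‖ = ‖(z - 1) + z * (w - 1)‖ := by congr 1; ring
    _ ≤ ‖z - 1‖ + ‖z * (w - 1)‖ := norm_add_le _ _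
    _ = _ := by rw [norm_mul, hz, one_mul]

lemma norm_wave_mul_conj_sub_one (d : ℕ) (φ : ℝ) (s t : ℕ) :
    ‖wave d φ s * conj (wave d φ t) - 1‖ = ‖wave d φ s - wave d φ t‖ := by
  have e : wave d φ s * conj (wave d φ t) - 1 =
      (wave d φ s - wave d φ t) * conj (wave d φ t) := by
    rw [sub_mul, Complex.mul_conj, Complex.normSq_eq_norm_sq, norm_wave]
    simp
  rw [e, norm_mul, Complex.norm_conj, norm_wave, mul_one]

/-- For a linear phase the translate by h differs from the wave by the constant factor exp(ihφ).
Averaging over `n / 2` ≥ n/3 values of t turns 2n into 6. -/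
lemma norm_cis_mul_sub_one_le_linear (φ : ℝ) {n h : ℕ} (hn : 2 ≤ n) (hh : h ≤ n / 2) :
    ‖cis (h * φ) - 1‖ ≤ 6 * waveDev 1 φ n := by
  have hρ := waveDev_nonneg 1 φ n
  have h1 := sum_wave_sub_wave_le 1 φ (a := 1) (b := h) (a' := 1) (b' := 0) (m := n / 2) (n := n)
    (by omega) one_ne_zero one_ne_zero (by omega) (by omega)
  have e : ∀ t : ℕ, ‖wave 1 φ (1 * t + h) - wave 1 φ (1 * t + 0)‖ = ‖cis (h * φ) - 1‖ := by
    intro t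
    rw [← norm_wave_mul_conj_sub_one]
    congr 2
    rw [wave, wave, conj_cis, ← cis_add]
    congr 1
    push_cast
    ring
  simp only [e, Finset.sum_const, Nat.card_Icc, Nat.add_sub_cancel, nsmul_eq_mul] at h1
  have hm : (n : ℝ) ≤ 3 * (n / 2 : ℕ) := by exact_mod_cast (by omega : n ≤ 3 * (n / 2))
  have hm0 : (0 : ℝ) < (n / 2 : ℕ) := by exact_mod_cast (by omega : 0 < n / 2)
  by_contra hcon
  push Not at hcon
  have := mul_lt_mul_of_pos_left hcon hm0
  nlinarith

/-- The second difference (t+h+k)² - (t+h)² + t² - (t+k)² = 2hk does not depend on t, so two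
comparisons of translates suffice. -/
lemma norm_cis_mul_sub_one_le_quadratic (φ : ℝ) {n h k : ℕ} (hn : 2 ≤ n) (hh : h + k ≤ n / 2) :
    ‖cis (2 * h * k * φ) - 1‖ ≤ 12 * waveDev 2 φ n := by
  have hρ := waveDev_nonneg 2 φ n
  have h1 := sum_wave_sub_wave_le 2 φ (a := 1) (b := h + k) (a' := 1) (b' := h) (m := n / 2)
    (n := n) (by omega) one_ne_zero one_ne_zero (by omega) (by omega)
  have h2 := sum_wave_sub_wave_le 2 φ (a := 1) (b := 0) (a' := 1) (b' := k) (m := n / 2)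
    (n := n) (by omega) one_ne_zero one_ne_zero (by omega) (by omega)
  have e : ∀ t : ℕ, ‖cis (2 * h * k * φ) - 1‖ ≤
      ‖wave 2 φ (1 * t + (h + k)) - wave 2 φ (1 * t + h)‖ +
      ‖wave 2 φ (1 * t + 0) - wave 2 φ (1 * t + k)‖ := by
    intro t
    rw [← norm_wave_mul_conj_sub_one, ← norm_wave_mul_conj_sub_one]
    refine le_trans (le_of_eq ?_) (norm_mul_sub_one_le (by simp))
    congr 2
    simp only [wave, conj_cis, ← cis_add]
    congr 1
    push_cast
    ring
  have h3 := Finset.sum_le_sum fun t (_ : t ∈ Finset.Icc 1 (n / 2)) => e t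
  rw [Finset.sum_add_distrib] at h3
  simp only [Finset.sum_const, Nat.card_Icc, Nat.add_sub_cancel, nsmul_eq_mul] at h3
  have hm : (n : ℝ) ≤ 3 * (n / 2 : ℕ) := by exact_mod_cast (by omega : n ≤ 3 * (n / 2))
  have hm0 : (0 : ℝ) < (n / 2 : ℕ) := by exact_mod_cast (by omega : 0 < n / 2)
  by_contra hcon
  push Not at hcon
  have := mul_lt_mul_of_pos_left hcon hm0
  nlinarith

/-- Second differences see only 2φ and leave open that φ is near π. The identity (2t)² - (2t+1)² +
2((t+1)² - t²) = 1 produces φ itself. -/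
lemma norm_cis_sub_one_le_quadratic (φ : ℝ) {n : ℕ} (hn : 3 ≤ n) :
    ‖cis φ - 1‖ ≤ 24 * waveDev 2 φ n := by
  have hρ := waveDev_nonneg 2 φ n
  have h1 := sum_wave_sub_wave_le 2 φ (a := 2) (b := 0) (a' := 2) (b' := 1) (m := (n - 1) / 2)
    (n := n) (by omega) two_ne_zero two_ne_zero (by omega) (by omega)
  have h2 := sum_wave_sub_wave_le 2 φ (a := 1) (b := 1) (a' := 1) (b' := 0) (m := (n - 1) / 2)
    (n := n) (by omega) one_ne_zero one_ne_zero (by omega) (by omega)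
  have e : ∀ t : ℕ, ‖cis φ - 1‖ ≤
      ‖wave 2 φ (2 * t + 0) - wave 2 φ (2 * t + 1)‖ +
      (‖wave 2 φ (1 * t + 1) - wave 2 φ (1 * t + 0)‖ +
      ‖wave 2 φ (1 * t + 1) - wave 2 φ (1 * t + 0)‖) := by
    intro t
    rw [← norm_wave_mul_conj_sub_one, ← norm_wave_mul_conj_sub_one]
    refine le_trans (le_of_eq ?_) ((norm_mul_sub_one_le (by simp)).trans
      (add_le_add le_rfl (norm_mul_sub_one_le (by simp))))
    congr 2
    simp only [wave, conj_cis, ← cis_add]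
    congr 1
    push_cast
    ring
  have h3 := Finset.sum_le_sum fun t (_ : t ∈ Finset.Icc 1 ((n - 1) / 2)) => e t
  simp only [Finset.sum_add_distrib] at h3
  simp only [Finset.sum_const, Nat.card_Icc, Nat.add_sub_cancel, nsmul_eq_mul] at h3
  have hm : (n : ℝ) ≤ 4 * ((n - 1) / 2 : ℕ) := by
    exact_mod_cast (by omega : n ≤ 4 * ((n - 1) / 2))
  have hm0 : (0 : ℝ) < ((n - 1) / 2 : ℕ) := by exact_mod_cast (by omega : 0 < (n - 1) / 2)
  by_contra hcon
  push Not at hcon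
  have := mul_lt_mul_of_pos_left hcon hm0
  nlinarith

/-- If the average of `exp(i φ t ^ d)` has modulus near one, then `φ` is near `0` modulo `2π`. -/
theorem norm_cis_sub_one_le_waveDev {d : ℕ} (hd : d = 1 ∨ d = 2) (φ : ℝ) {n : ℕ} (hn : 4 ≤ n) :
    ‖cis φ - 1‖ ≤ 24 * waveDev d φ n := by
  rcases hd with rfl | rfl
  · have h := norm_cis_mul_sub_one_le_linear φ (n := n) (h := 1) (by omega) (by omega)
    rw [Nat.cast_one, one_mul] at h
    linarith [waveDev_nonneg 1 φ n]
  · exact norm_cis_sub_one_le_quadratic φ (by omega)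

/-- If the average of `exp(i φ t ^ d)` has modulus near one and `φ` is reduced modulo `2π`, then
`φ n ^ d` is small. -/
theorem abs_mul_pow_le_waveDev {d : ℕ} (hd : d = 1 ∨ d = 2) {φ : ℝ} {n : ℕ} (hn : 4 ≤ n)
    (hφ : |φ| ≤ Real.pi) (hρ : waveDev d φ n ≤ 1 / 24) :
    |φ| * (n : ℝ) ^ d ≤ 700 * waveDev d φ n := by
  have hρ0 := waveDev_nonneg d φ n
  have hpi := Real.pi_pos
  have hpi' := Real.pi_lt_d2
  have hφ0 := abs_nonneg φ
  rcases hd with rfl | rfl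
  · have h := nat_mul_abs_le_of_norm_cis (N := n / 2) hφ (by positivity) (by linarith)
      fun k hk => norm_cis_mul_sub_one_le_linear φ (n := n) (h := k) (by omega) hk
    have hm : (n : ℝ) ≤ 3 * (n / 2 : ℕ) := by exact_mod_cast (by omega : n ≤ 3 * (n / 2))
    rw [pow_one]
    nlinarith
  -- The threshold 1/24 first yields |φ| ≤ π/2. Discrete continuity then applies twice: to the
  -- multiples of 2φ up to n/4, and to the multiples of 2(n/4)φ up to n/4, which reaches the order
  -- n²φ.
  · have h0 := abs_le_of_norm_cis_sub_one hφ
    have h1 := norm_cis_sub_one_le_waveDev (Or.inr rfl) φ hn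
    have h2 : |2 * φ| ≤ Real.pi := by
      rw [abs_mul, abs_two]
      nlinarith
    have hN : 1 ≤ n / 4 := by omega
    have h3 := nat_mul_abs_le_of_norm_cis (N := n / 4) (δ := 12 * waveDev 2 φ n) h2 (by positivity)
      (by linarith) fun k hk => by
        have := norm_cis_mul_sub_one_le_quadratic φ (n := n) (h := k) (k := 1) (by omega) (by omega)
        rwa [Nat.cast_one, mul_one, mul_comm (2 : ℝ), mul_assoc] at this
    have h4 : |2 * (n / 4 : ℕ) * φ| ≤ Real.pi := by
      rw [abs_mul, abs_mul, Nat.abs_cast, abs_two]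
      rw [abs_mul, abs_two] at h3
      nlinarith
    have h5 := nat_mul_abs_le_of_norm_cis (N := n / 4) (δ := 12 * waveDev 2 φ n) h4 (by positivity)
      (by linarith) fun k hk => by
        have := norm_cis_mul_sub_one_le_quadratic φ (n := n) (h := n / 4) (k := k) (by omega)
          (by omega)
        rwa [show (k : ℝ) * (2 * (n / 4 : ℕ) * φ) = 2 * (n / 4 : ℕ) * k * φ by ring]
    rw [abs_mul, abs_mul, Nat.abs_cast, abs_two] at h5
    have hm : (n : ℝ) ≤ 8 * (n / 4 : ℕ) := by exact_mod_cast (by omega : n ≤ 8 * (n / 4))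
    have hm2 : (n : ℝ) ^ 2 ≤ (8 * (n / 4 : ℕ)) ^ 2 := by gcongr
    nlinarith

end Rigidity

/-! ### Components and their mean squares. -/

section Components

/-- `A cos(φ t ^ d) + B sin(φ t ^ d)` for `θ = (A, B, φ)`. -/
noncomputable def comp (d : ℕ) (θ : Param) (t : ℕ) : ℝ :=
  θ.1 * Real.cos (θ.2.2 * (t : ℝ) ^ d) + θ.2.1 * Real.sin (θ.2.2 * (t : ℝ) ^ d)

lemma sinusoid_eq_comp : sinusoid = comp 1 := by
  ext θ t; simp [sinusoid, comp]

lemma chirp_eq_comp : chirp = comp 2 := rfl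

/-- The complex amplitude of a component. -/
noncomputable def amp (θ : Param) : ℂ := ⟨θ.1, -θ.2.1⟩

lemma comp_eq_re (d : ℕ) (θ : Param) (t : ℕ) : comp d θ t = (amp θ * wave d θ.2.2 t).re := by
  simp [comp, amp, wave, Complex.mul_re, re_cis, im_cis]

lemma norm_amp_sq (θ : Param) : ‖amp θ‖ ^ 2 = power θ := by
  rw [← Complex.normSq_eq_norm_sq, Complex.normSq_apply]
  simp only [amp, power]; ring

lemma abs_comp_le (d : ℕ) (θ : Param) (t : ℕ) : |comp d θ t| ≤ ‖amp θ‖ := by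
  rw [comp_eq_re]
  refine (Complex.abs_re_le_norm _).trans ?_
  rw [norm_mul, norm_wave, mul_one]

/-- The root mean square of `F` over `1, …, n`. -/
noncomputable def rms (n : ℕ) (F : ℕ → ℝ) : ℝ := √(avg n (fun t => F t ^ 2))

lemma rms_nonneg (n : ℕ) (F : ℕ → ℝ) : 0 ≤ rms n F := Real.sqrt_nonneg _

lemma rms_sq (n : ℕ) (F : ℕ → ℝ) : rms n F ^ 2 = avg n (fun t => F t ^ 2) :=
  Real.sq_sqrt (avg_nonneg fun _ => sq_nonneg _)

lemma abs_avg_mul_le_rms (n : ℕ) (F G : ℕ → ℝ) :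
    |avg n (fun t => F t * G t)| ≤ rms n F * rms n G := abs_avg_mul_le n F G

lemma avg_abs_le_rms (n : ℕ) (F : ℕ → ℝ) : avg n (fun t => |F t|) ≤ rms n F := by
  refine Real.le_sqrt_of_sq_le ?_
  have := norm_avg_sq_le n (fun t => |F t|)
  rw [Real.norm_eq_abs, sq_abs] at this
  simpa using this

lemma rms_comp_le (n d : ℕ) (θ : Param) : rms n (comp d θ) ≤ ‖amp θ‖ := by
  refine Real.sqrt_le_left (norm_nonneg _) |>.2 ?_
  refine avg_le_const (by positivity) fun t => ?_
  rw [← sq_abs]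
  gcongr
  exact abs_comp_le d θ t

lemma abs_avg_mul_comp_le_norm (n d : ℕ) (θ : Param) (v : ℕ → ℝ) :
    |avg n (fun t => v t * comp d θ t)| ≤
      ‖amp θ‖ * ‖avg n (fun t => (v t : ℂ) * wave d θ.2.2 t)‖ := by
  have e : avg n (fun t => v t * comp d θ t) =
      (amp θ * avg n (fun t => (v t : ℂ) * wave d θ.2.2 t)).re := by
    rw [← avg_const_mul, reCLM_avg]
    congr 1
    ext t
    rw [comp_eq_re, ← Complex.re_ofReal_mul]
    congr 1
    ring
  rw [e, ← norm_mul]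
  exact Complex.abs_re_le_norm _

lemma rms_comp_sq_eq {n : ℕ} (hn : n ≠ 0) (d : ℕ) (θ : Param) :
    rms n (comp d θ) ^ 2 =
      (power θ + (amp θ ^ 2 * avg n (wave d (2 * θ.2.2))).re) / 2 := by
  have e : ∀ t, comp d θ t ^ 2 =
      (1 / 2) * (power θ + (amp θ ^ 2 * wave d (2 * θ.2.2) t).re) := by
    intro t
    have h1 : amp θ ^ 2 * wave d (2 * θ.2.2) t = (amp θ * wave d θ.2.2 t) ^ 2 := by
      rw [two_mul, wave_add]; ring
    have h2 : power θ = ‖amp θ * wave d θ.2.2 t‖ ^ 2 := by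
      rw [norm_mul, norm_wave, mul_one, norm_amp_sq]
    rw [h1, h2, comp_eq_re]
    generalize amp θ * wave d θ.2.2 t = z
    rw [← Complex.normSq_eq_norm_sq, Complex.normSq_apply, sq z, Complex.mul_re]
    ring
  rw [rms_sq]
  simp only [e]
  rw [avg_const_mul, avg_add, avg_const hn, ← reCLM_avg, avg_const_mul]
  ring

/-- The square of a component oscillates around half its power with the doubled frequency. So the
root mean square controls the amplitudes unless the doubled frequency has an average of modulus near
one. -/
lemma power_mul_le_rms_sq {n : ℕ} (hn : n ≠ 0) (d : ℕ) (θ : Param) :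
    power θ * (1 - ‖avg n (wave d (2 * θ.2.2))‖) ≤ 2 * rms n (comp d θ) ^ 2 := by
  rw [rms_comp_sq_eq hn]
  have h := Complex.abs_re_le_norm (amp θ ^ 2 * avg n (wave d (2 * θ.2.2)))
  rw [norm_mul, norm_pow, norm_amp_sq] at h
  linarith [neg_abs_le (amp θ ^ 2 * avg n (wave d (2 * θ.2.2))).re]

end Components

/-! ### Summation by parts. -/

section Abel

lemma sum_mul_eq_abel (v k : ℕ → ℝ) (n : ℕ) :
    ∑ t ∈ Finset.Icc 1 n, v t * k t = (∑ t ∈ Finset.Icc 1 n, v t) * k (n + 1) -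
      ∑ t ∈ Finset.Icc 1 n, (∑ s ∈ Finset.Icc 1 t, v s) * (k (t + 1) - k t) := by
  induction n with
  | zero => simp
  | succ n ih =>
    rw [Finset.sum_Icc_succ_top (by omega) (fun t => v t * k t), ih,
      Finset.sum_Icc_succ_top (by omega)
        (fun t => (∑ s ∈ Finset.Icc 1 t, v s) * (k (t + 1) - k t)),
      Finset.sum_Icc_succ_top (by omega) v]
    ring

lemma abs_sum_mul_le_abel {v k : ℕ → ℝ} {n : ℕ} {B V W : ℝ}
    (hB : ∀ m ≤ n, |∑ t ∈ Finset.Icc 1 m, v t| ≤ B)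
    (hV : ∑ t ∈ Finset.Icc 1 n, |k (t + 1) - k t| ≤ V) (hW : |k (n + 1)| ≤ W) :
    |∑ t ∈ Finset.Icc 1 n, v t * k t| ≤ B * (V + W) := by
  have hB0 : 0 ≤ B := (abs_nonneg _).trans (hB 0 (Nat.zero_le _))
  rw [sum_mul_eq_abel]
  refine (abs_sub _ _).trans ?_
  rw [mul_add, add_comm]
  gcongr
  · refine (Finset.abs_sum_le_sum_abs _ _).trans ?_
    calc ∑ t ∈ Finset.Icc 1 n, |(∑ s ∈ Finset.Icc 1 t, v s) * (k (t + 1) - k t)|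
        ≤ ∑ t ∈ Finset.Icc 1 n, B * |k (t + 1) - k t| := by
          gcongr with t ht
          rw [abs_mul]
          gcongr
          exact hB t (Finset.mem_Icc.1 ht).2
      _ ≤ _ := by rw [← Finset.mul_sum]; gcongr
  · rw [abs_mul]
    gcongr
    exact hB n le_rfl

/-- Short partial sums are below a constant, which ε n eventually exceeds; long ones are at most ε
m. -/
lemma eventually_partial_sums_le {v : ℕ → ℝ} (hv : Tendsto (fun n => avg n v) atTop (𝓝 0))
    {ε : ℝ} (hε : 0 < ε) :
    ∀ᶠ n : ℕ in atTop, ∀ m ≤ n, |∑ t ∈ Finset.Icc 1 m, v t| ≤ ε * n := by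
  rw [Metric.tendsto_atTop] at hv
  obtain ⟨N, hN⟩ := hv ε hε
  set K := ∑ t ∈ Finset.Icc 1 N, |v t| with hK
  obtain ⟨N', hN'⟩ := exists_nat_ge (K / ε)
  filter_upwards [eventually_ge_atTop N'] with n hn m hm
  have hmn : (m : ℝ) ≤ n := by exact_mod_cast hm
  rcases lt_or_ge m N with hmN | hmN
  · refine (Finset.abs_sum_le_sum_abs _ _).trans ?_
    have h1 : ∑ t ∈ Finset.Icc 1 m, |v t| ≤ K :=
      Finset.sum_le_sum_of_subset_of_nonneg (Finset.Icc_subset_Icc le_rfl hmN.le)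
        fun i _ _ => abs_nonneg _
    have h2 : K / ε ≤ n := hN'.trans (by exact_mod_cast hn)
    rw [div_le_iff₀ hε] at h2
    linarith
  · rcases Nat.eq_zero_or_pos m with rfl | hm0
    · simp; positivity
    have hm0' : (0 : ℝ) < m := by exact_mod_cast hm0
    have h1 := (hN m hmN).le
    rw [dist_zero_right, avg, smul_eq_mul, Real.norm_eq_abs, abs_mul, abs_inv, Nat.abs_cast,
      inv_mul_le_iff₀ hm0'] at h1
    nlinarith

end Abel

/-! ### Inner products with a component, uniformly in its parameters. -/

section KeyInequality

lemma pow_sub_pow_ge {d : ℕ} (hd : d = 1 ∨ d = 2) (t m : ℕ) :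
    (m : ℝ) ^ d ≤ ((t + m : ℕ) : ℝ) ^ d - (t : ℝ) ^ d := by
  have ht : (0 : ℝ) ≤ t := Nat.cast_nonneg t
  have hm : (0 : ℝ) ≤ m := Nat.cast_nonneg m
  rcases hd with rfl | rfl
  · push_cast; linarith
  · push_cast; nlinarith

/-- The coefficients of a slowly varying component are bounded by its root mean square. -/
lemma coeff_le_rms_of_slow {d : ℕ} (hd : d = 1 ∨ d = 2) {A B γ : ℝ} {n : ℕ} (hn : 4 ≤ n)
    (hγ : |γ| * (n : ℝ) ^ d ≤ 1) :
    |A| ≤ 90 * rms n (comp d (A, B, γ)) ∧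
      |B| * (|γ| * (n : ℝ) ^ d) ≤ 90 * rms n (comp d (A, B, γ)) := by
  set g := comp d (A, B, γ) with hg
  set m := n / 2 with hm
  have hn0 : (0 : ℝ) < n := by exact_mod_cast (by omega : 0 < n)
  have hm3 : (n : ℝ) ≤ 3 * m := by exact_mod_cast (by omega : n ≤ 3 * m)
  have hpi := Real.pi_pos
  have hpi' := Real.pi_lt_d2
  have hnm : (n : ℝ) ^ d ≤ 9 * (m : ℝ) ^ d := by
    rcases hd with rfl | rfl
    · simp only [pow_one]; nlinarith
    · calc (n : ℝ) ^ 2 ≤ (3 * m) ^ 2 := by gcongr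
        _ = _ := by ring
  have hnd : 0 < (n : ℝ) ^ d := by positivity
  have key : ∀ t ∈ Finset.Icc 1 m, |A| ≤ 15 * (|g (1 * t + 0)| + |g (1 * t + m)|) ∧
      |B| * (|γ| * (n : ℝ) ^ d) ≤ 15 * (|g (1 * t + 0)| + |g (1 * t + m)|) := by
    intro t ht
    rw [one_mul, add_zero]
    have htm := (Finset.mem_Icc.1 ht).2
    have hg0 := abs_nonneg (g t)
    have hg1 := abs_nonneg (g (t + m))
    by_cases hγ0 : γ = 0
    · have : g t = A := by simp [hg, comp, hγ0]
      rw [this] at hg0 ⊢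
      rw [hγ0]
      constructor
      · linarith
      · simp only [abs_zero, zero_mul, mul_zero]; positivity
    have hγp : 0 < |γ| := abs_pos.2 hγ0
    set x := (t : ℝ) ^ d with hx
    set y := ((t + m : ℕ) : ℝ) ^ d with hy
    have hxy : (m : ℝ) ^ d ≤ y - x := pow_sub_pow_ge hd t m
    have hx0 : 0 ≤ x := by positivity
    have hyn : y ≤ (n : ℝ) ^ d := by
      have : ((t + m : ℕ) : ℝ) ≤ n := by exact_mod_cast (by omega : t + m ≤ n)
      exact pow_le_pow_left₀ (by positivity) this d
    have hyx : (n : ℝ) ^ d ≤ 9 * (y - x) := by linarith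
    have hsin : 2 / Real.pi * (|γ| * (y - x)) ≤ |Real.sin (γ * (y - x))| := by
      have h1 : |γ * (y - x)| = |γ| * (y - x) := by
        rw [abs_mul, abs_of_nonneg (by linarith : 0 ≤ y - x)]
      rw [← h1]
      apply Real.mul_abs_le_abs_sin
      rw [h1]
      have := Real.pi_gt_three
      nlinarith
    have hgt : g t = A * Real.cos (γ * x) + B * Real.sin (γ * x) := rfl
    have hgu : g (t + m) = A * Real.cos (γ * y) + B * Real.sin (γ * y) := rfl
    have hc : ∀ z : ℝ, Real.cos z ^ 2 + Real.sin z ^ 2 = 1 := Real.cos_sq_add_sin_sq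
    -- Cramer's rule for the values of g at t and t + m, with determinant sin(γ(y - x)).
    have hA : A * Real.sin (γ * (y - x)) =
        g t * Real.sin (γ * y) - g (t + m) * Real.sin (γ * x) := by
      rw [hgt, hgu, mul_sub, Real.sin_sub]; ring
    have hB : B * Real.sin (γ * (y - x)) =
        g (t + m) * Real.cos (γ * x) - g t * Real.cos (γ * y) := by
      rw [hgt, hgu, mul_sub, Real.sin_sub]; ring
    have hsy : ∀ z : ℝ, 0 ≤ z → z ≤ (n : ℝ) ^ d → |Real.sin (γ * z)| ≤ |γ| * (n : ℝ) ^ d := by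
      intro z hz0 hz
      refine Real.abs_sin_le_abs.trans ?_
      rw [abs_mul, abs_of_nonneg hz0]
      gcongr
    have hA' : |A| * (2 / Real.pi * (|γ| * (y - x))) ≤
        (|g t| + |g (t + m)|) * (|γ| * (n : ℝ) ^ d) := by
      calc _ ≤ |A| * |Real.sin (γ * (y - x))| := by gcongr
        _ = |g t * Real.sin (γ * y) - g (t + m) * Real.sin (γ * x)| := by rw [← abs_mul, hA]
        _ ≤ |g t| * |Real.sin (γ * y)| + |g (t + m)| * |Real.sin (γ * x)| := by
          rw [← abs_mul, ← abs_mul]; exact abs_sub _ _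
        _ ≤ |g t| * (|γ| * (n : ℝ) ^ d) + |g (t + m)| * (|γ| * (n : ℝ) ^ d) := by
          gcongr
          · exact hsy y (by linarith) hyn
          · exact hsy x hx0 (by linarith)
        _ = _ := by ring
    have hB' : |B| * (2 / Real.pi * (|γ| * (y - x))) ≤ |g t| + |g (t + m)| := by
      calc _ ≤ |B| * |Real.sin (γ * (y - x))| := by gcongr
        _ = |g (t + m) * Real.cos (γ * x) - g t * Real.cos (γ * y)| := by rw [← abs_mul, hB]
        _ ≤ |g (t + m)| * |Real.cos (γ * x)| + |g t| * |Real.cos (γ * y)| := by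
          rw [← abs_mul, ← abs_mul]; exact abs_sub _ _
        _ ≤ |g (t + m)| * 1 + |g t| * 1 := by
          gcongr <;> exact Real.abs_cos_le_one _
        _ = _ := by ring
    -- Since y - x ≥ n^d/9 and 15 · 2/π ≥ 9, the determinant has modulus at least |γ| n^d/15.
    have hconst : |γ| * (n : ℝ) ^ d ≤ 15 * (2 / Real.pi * (|γ| * (y - x))) := by
      have h1 : |γ| * (n : ℝ) ^ d ≤ |γ| * (9 * (y - x)) := by gcongr
      have h2 : 9 ≤ 15 * (2 / Real.pi) := by
        rw [mul_div_assoc', le_div_iff₀ hpi]; linarith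
      have h3 : 0 ≤ |γ| * (y - x) := mul_nonneg hγp.le (by linarith)
      nlinarith
    constructor
    · have h1 : |A| * (|γ| * (n : ℝ) ^ d) ≤
          15 * (|g t| + |g (t + m)|) * (|γ| * (n : ℝ) ^ d) := by
        calc _ ≤ |A| * (15 * (2 / Real.pi * (|γ| * (y - x)))) := by gcongr
          _ ≤ _ := by linarith
      exact le_of_mul_le_mul_right h1 (by positivity)
    · calc _ ≤ |B| * (15 * (2 / Real.pi * (|γ| * (y - x)))) := by gcongr
        _ ≤ _ := by linarith
  have hsum : ∑ t ∈ Finset.Icc 1 m, 15 * (|g (1 * t + 0)| + |g (1 * t + m)|) ≤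
      30 * (n * rms n g) := by
    have h1 := sum_comp_affine_le (D := fun t => |g t|) (fun t => abs_nonneg _) (a := 1) (b := 0)
      (m := m) (n := n) one_ne_zero (by omega)
    have h2 := sum_comp_affine_le (D := fun t => |g t|) (fun t => abs_nonneg _) (a := 1) (b := m)
      (m := m) (n := n) one_ne_zero (by omega)
    have h3 := avg_abs_le_rms n g
    rw [avg, smul_eq_mul, inv_mul_le_iff₀ hn0] at h3
    rw [← Finset.mul_sum, Finset.sum_add_distrib]
    linarith
  have hr := rms_nonneg n g
  -- The sum runs over m ≥ n/3 values of t, so 30 becomes 90.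
  have fin : ∀ c : ℝ, (∀ t ∈ Finset.Icc 1 m, c ≤ 15 * (|g (1 * t + 0)| + |g (1 * t + m)|)) →
      0 ≤ c → c ≤ 90 * rms n g := by
    intro c hc hc0
    have h1 := (Finset.sum_le_sum hc).trans hsum
    simp only [Finset.sum_const, Nat.card_Icc, Nat.add_sub_cancel, nsmul_eq_mul] at h1
    have h2 : n * c ≤ n * (90 * rms n g) := by nlinarith
    exact le_of_mul_le_mul_left h2 hn0
  exact ⟨fin _ (fun t ht => (key t ht).1) (abs_nonneg _),
    fin _ (fun t ht => (key t ht).2) (by positivity)⟩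

/-- Summation by parts: total variation and end value of a slow component are bounded by its root
mean square, even for huge B, because B enters only through |B| |γ| n^d. -/
lemma abs_avg_mul_comp_le_of_slow {d : ℕ} (hd : d = 1 ∨ d = 2) {A B γ : ℝ} {n : ℕ} (hn : 4 ≤ n)
    (hγ : |γ| * (n : ℝ) ^ d ≤ 1) {v : ℕ → ℝ} {K : ℝ}
    (hK : ∀ m ≤ n, |∑ t ∈ Finset.Icc 1 m, v t| ≤ K * n) :
    |avg n (fun t => v t * comp d (A, B, γ) t)| ≤ 1200 * rms n (comp d (A, B, γ)) * K := by
  obtain ⟨hA, hB⟩ := coeff_le_rms_of_slow (A := A) (B := B) hd hn hγ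
  set g := comp d (A, B, γ) with hg
  have hn0 : (0 : ℝ) < n := by exact_mod_cast (by omega : 0 < n)
  have hK0 : 0 ≤ K := by
    have := (abs_nonneg _).trans (hK 0 (Nat.zero_le _))
    exact nonneg_of_mul_nonneg_left this hn0
  have hr := rms_nonneg n g
  have hend : ((n + 1 : ℕ) : ℝ) ^ d ≤ 4 * (n : ℝ) ^ d := by
    have h1 : (1 : ℝ) ≤ n := by exact_mod_cast (by omega : 1 ≤ n)
    rcases hd with rfl | rfl
    · push_cast; linarith
    · push_cast; nlinarith
  have hγ4 : |γ| * ((n + 1 : ℕ) : ℝ) ^ d ≤ 4 * (|γ| * (n : ℝ) ^ d) := by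
    nlinarith [abs_nonneg γ]
  have hV : ∑ t ∈ Finset.Icc 1 n, |g (t + 1) - g t| ≤ 720 * rms n g := by
    have hstep : ∀ t ∈ Finset.Icc 1 n, |g (t + 1) - g t| ≤
        (|A| + |B|) * |γ| * (((t + 1 : ℕ) : ℝ) ^ d - (t : ℝ) ^ d) := by
      intro t _
      have hmono : (0 : ℝ) ≤ ((t + 1 : ℕ) : ℝ) ^ d - (t : ℝ) ^ d := by
        rw [sub_nonneg]
        gcongr
        omega
      have e : g (t + 1) - g t =
          A * (Real.cos (γ * ((t + 1 : ℕ) : ℝ) ^ d) - Real.cos (γ * (t : ℝ) ^ d)) +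
          B * (Real.sin (γ * ((t + 1 : ℕ) : ℝ) ^ d) - Real.sin (γ * (t : ℝ) ^ d)) := by
        simp only [hg, comp]; ring
      have hd1 : |γ * ((t + 1 : ℕ) : ℝ) ^ d - γ * (t : ℝ) ^ d| =
          |γ| * (((t + 1 : ℕ) : ℝ) ^ d - (t : ℝ) ^ d) := by
        rw [← mul_sub, abs_mul, abs_of_nonneg hmono]
      have h1 : |Real.cos (γ * ((t + 1 : ℕ) : ℝ) ^ d) - Real.cos (γ * (t : ℝ) ^ d)| ≤
          |γ| * (((t + 1 : ℕ) : ℝ) ^ d - (t : ℝ) ^ d) := by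
        have := Real.lipschitzWith_cos.dist_le_mul (γ * ((t + 1 : ℕ) : ℝ) ^ d) (γ * (t : ℝ) ^ d)
        simpa only [Real.dist_eq, NNReal.coe_one, one_mul, hd1] using this
      have h2 : |Real.sin (γ * ((t + 1 : ℕ) : ℝ) ^ d) - Real.sin (γ * (t : ℝ) ^ d)| ≤
          |γ| * (((t + 1 : ℕ) : ℝ) ^ d - (t : ℝ) ^ d) := by
        have := Real.lipschitzWith_sin.dist_le_mul (γ * ((t + 1 : ℕ) : ℝ) ^ d) (γ * (t : ℝ) ^ d)
        simpa only [Real.dist_eq, NNReal.coe_one, one_mul, hd1] using this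
      rw [e]
      refine (abs_add_le _ _).trans ?_
      rw [abs_mul, abs_mul, add_mul, add_mul, mul_assoc, mul_assoc]
      gcongr
    refine (Finset.sum_le_sum hstep).trans ?_
    rw [← Finset.mul_sum, Finset.sum_sub_distrib,
      sum_Icc_shift_sub (fun t : ℕ => (t : ℝ) ^ d) n, Nat.cast_one, one_pow]
    calc (|A| + |B|) * |γ| * (((n + 1 : ℕ) : ℝ) ^ d - 1)
        ≤ (|A| + |B|) * |γ| * ((n + 1 : ℕ) : ℝ) ^ d := by gcongr; linarith
      _ = (|A| + |B|) * (|γ| * ((n + 1 : ℕ) : ℝ) ^ d) := by ring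
      _ ≤ (|A| + |B|) * (4 * (|γ| * (n : ℝ) ^ d)) := by gcongr
      _ = 4 * (|A| * (|γ| * (n : ℝ) ^ d)) + 4 * (|B| * (|γ| * (n : ℝ) ^ d)) := by ring
      _ ≤ 4 * (|A| * 1) + 4 * (|B| * (|γ| * (n : ℝ) ^ d)) := by gcongr
      _ ≤ _ := by linarith
  have hW : |g (n + 1)| ≤ 450 * rms n g := by
    have e : g (n + 1) = A * Real.cos (γ * ((n + 1 : ℕ) : ℝ) ^ d) +
        B * Real.sin (γ * ((n + 1 : ℕ) : ℝ) ^ d) := rfl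
    rw [e]
    refine (abs_add_le _ _).trans ?_
    rw [abs_mul, abs_mul]
    have h1 : |A| * |Real.cos (γ * ((n + 1 : ℕ) : ℝ) ^ d)| ≤ |A| * 1 := by
      gcongr; exact Real.abs_cos_le_one _
    have h2 : |B| * |Real.sin (γ * ((n + 1 : ℕ) : ℝ) ^ d)| ≤
        |B| * (4 * (|γ| * (n : ℝ) ^ d)) := by
      gcongr
      refine Real.abs_sin_le_abs.trans ?_
      rwa [abs_mul, abs_of_nonneg (by positivity : (0 : ℝ) ≤ ((n + 1 : ℕ) : ℝ) ^ d)]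
    linarith
  have h := abs_sum_mul_le_abel (k := g) hK hV hW
  rw [avg, smul_eq_mul, abs_mul, abs_inv, Nat.abs_cast, inv_mul_le_iff₀ hn0]
  refine h.trans ?_
  have : 0 ≤ K * n * rms n g := by positivity
  linarith

/-- The power t^d has the parity of t, so adding π to the frequency multiplies by a sign. This
carries frequencies near π to frequencies near 0. -/
lemma comp_add_pi {d : ℕ} (hd : d ≠ 0) (A B γ : ℝ) (t : ℕ) :
    comp d (A, B, γ + Real.pi) t = (-1) ^ t * comp d (A, B, γ) t := by
  have hpar : ((-1 : ℝ)) ^ (t ^ d) = (-1) ^ t := by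
    rcases Nat.even_or_odd t with ht | ht
    · rw [ht.neg_one_pow, (ht.pow_of_ne_zero hd).neg_one_pow]
    · rw [ht.neg_one_pow, ht.pow.neg_one_pow]
  have e : (γ + Real.pi) * (t : ℝ) ^ d = γ * (t : ℝ) ^ d + (t ^ d : ℕ) * Real.pi := by
    push_cast; ring
  simp only [comp]
  rw [e, Real.cos_add_nat_mul_pi, Real.sin_add_nat_mul_pi, hpar]
  ring

/-- A bound for inner products with a component, relative to its root mean square, that is uniform
in the frequency and the amplitudes. -/
theorem abs_avg_mul_comp_le {d : ℕ} (hd : d = 1 ∨ d = 2) {θ : Param}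
    (hθ : θ.2.2 ∈ Set.Icc 0 Real.pi) {n : ℕ} (hn : 4 ≤ n) {v : ℕ → ℝ} {K : ℝ}
    (hK : ∀ m ≤ n, |∑ t ∈ Finset.Icc 1 m, v t| ≤ K * n)
    (hK' : ∀ m ≤ n, |∑ t ∈ Finset.Icc 1 m, (-1) ^ t * v t| ≤ K * n) :
    |avg n (fun t => v t * comp d θ t)| ≤ 2800 * rms n (comp d θ) *
      (‖avg n (fun t => (v t : ℂ) * wave d θ.2.2 t)‖ + K) := by
  obtain ⟨A, B, φ⟩ := θ
  obtain ⟨h0, hπ⟩ := hθ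
  simp only at h0 hπ ⊢
  have hn0 : (0 : ℝ) < n := by exact_mod_cast (by omega : 0 < n)
  have hK0 : 0 ≤ K := by
    have := (abs_nonneg _).trans (hK 0 (Nat.zero_le _))
    exact nonneg_of_mul_nonneg_left this hn0
  set r := rms n (comp d (A, B, φ)) with hr
  have hr0 : 0 ≤ r := rms_nonneg _ _
  set W := ‖avg n (fun t => (v t : ℂ) * wave d φ t)‖ with hW
  have hW0 : 0 ≤ W := norm_nonneg _
  -- Below the threshold, 700/1400 = 1/2 bounds |2φ| n^d for φ reduced modulo π. Above it, 1 - E ≥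
  -- (1 - E²)/2 ≥ 1/(2 · 1400²) bounds the power by (2800 r)².
  rcases lt_or_ge (1 / 1400) (waveDev d (2 * φ) n) with hdev | hdev
  · have hE := norm_avg_wave_le d (2 * φ) n
    have hE0 := norm_nonneg (avg n (wave d (2 * φ)))
    set E := ‖avg n (wave d (2 * φ))‖
    have h1 : (1 / 1400) ^ 2 < 1 - E ^ 2 := by
      rw [waveDev] at hdev
      exact (Real.lt_sqrt (by norm_num)).1 hdev
    have h2 := power_mul_le_rms_sq (n := n) (by omega) d (A, B, φ)
    have h3 : ‖amp (A, B, φ)‖ ≤ 2800 * r := by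
      apply abs_le_of_sq_le_sq' _ (by positivity) |>.2
      rw [norm_amp_sq]
      have hp : 0 ≤ power (A, B, φ) := by rw [← norm_amp_sq]; positivity
      have h4 : 1 / (2 * 1400 ^ 2) ≤ 1 - E := by nlinarith
      have h5 : power (A, B, φ) * (1 / (2 * 1400 ^ 2)) ≤ power (A, B, φ) * (1 - E) := by gcongr
      have h6 : power (A, B, φ) * (1 - E) ≤ 2 * r ^ 2 := h2
      linarith
    refine (abs_avg_mul_comp_le_norm n d (A, B, φ) v).trans ?_
    have : ‖amp (A, B, φ)‖ * W ≤ 2800 * r * W := by gcongr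
    have h7 : 0 ≤ 2800 * r * K := by positivity
    change ‖amp (A, B, φ)‖ * W ≤ _
    linarith
  · have hWr : 0 ≤ r * W := by positivity
    have hrK : 0 ≤ r * K := by positivity
    have hpi := Real.pi_pos
    rcases le_total φ (Real.pi / 2) with hφ | hφ
    · have h1 := abs_mul_pow_le_waveDev hd hn (φ := 2 * φ)
        (by rw [abs_of_nonneg (by linarith)]; linarith) (by linarith)
      have h2 : |φ| * (n : ℝ) ^ d ≤ 1 := by
        rw [abs_mul, abs_two] at h1
        linarith
      have := abs_avg_mul_comp_le_of_slow (A := A) (B := B) hd hn h2 hK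
      nlinarith
    · obtain ⟨γ, rfl⟩ : ∃ γ, φ = γ + Real.pi := ⟨φ - Real.pi, by ring⟩
      have hw : waveDev d (2 * (γ + Real.pi)) n = waveDev d (2 * γ) n := by
        have : wave d (2 * (γ + Real.pi)) = wave d (2 * γ) := by
          funext t
          rw [mul_add, wave_add, wave_two_pi, mul_one]
        rw [waveDev, this, ← waveDev]
      rw [hw] at hdev
      have h1 := abs_mul_pow_le_waveDev hd hn (φ := 2 * γ)
        (by rw [abs_of_nonpos (by linarith)]; linarith) (by linarith)
      have h2 : |γ| * (n : ℝ) ^ d ≤ 1 := by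
        rw [abs_mul, abs_two] at h1
        linarith
      have h3 := abs_avg_mul_comp_le_of_slow (A := A) (B := B) hd hn h2 hK'
      have hd0 : d ≠ 0 := by rcases hd with rfl | rfl <;> norm_num
      have e1 : rms n (comp d (A, B, γ)) = r := by
        simp only [hr, rms, comp_add_pi hd0, mul_pow, ← pow_mul, mul_comm _ 2]
        simp
      have e2 : (fun t => v t * comp d (A, B, γ + Real.pi) t) =
          fun t => (-1) ^ t * v t * comp d (A, B, γ) t := by
        ext t
        rw [comp_add_pi hd0]; ring
      rw [e1] at h3
      rw [e2]
      nlinarith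

theorem eventually_abs_avg_mul_comp_le {d : ℕ} (hd : d = 1 ∨ d = 2) {l : Filter ℕ}
    (hl : l ≤ atTop) {θ : ℕ → Param} (hθ : ∀ᶠ n in l, (θ n).2.2 ∈ Set.Icc 0 Real.pi) {v : ℕ → ℝ}
    (h₁ : Tendsto (fun n => avg n (fun t => (v t : ℂ) * wave d (θ n).2.2 t)) l (𝓝 0))
    (h₂ : Tendsto (fun n => avg n v) atTop (𝓝 0))
    (h₃ : Tendsto (fun n => avg n (fun t => (-1) ^ t * v t)) atTop (𝓝 0))
    {ε : ℝ} (hε : 0 < ε) :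
    ∀ᶠ n in l, |avg n (fun t => v t * comp d (θ n) t)| ≤ ε * rms n (comp d (θ n)) := by
  have hε' : 0 < ε / 5600 := by positivity
  have hn := h₁.norm
  rw [norm_zero] at hn
  filter_upwards [hθ, hn.eventually (ge_mem_nhds hε'), hl (eventually_partial_sums_le h₂ hε'),
    hl (eventually_partial_sums_le h₃ hε'), hl (eventually_ge_atTop 4)] with n hθn hw h2 h3 h4
  refine (abs_avg_mul_comp_le hd hθn h4 h2 h3).trans ?_
  have := rms_nonneg n (comp d (θ n))
  nlinarith

end KeyInequality

/-! ### Data asymptotically orthogonal to all components. -/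

section Negligible

/-- The empirical inner product of `F` and `G` over `1, …, n`. -/
noncomputable def ip (n : ℕ) (F G : ℕ → ℝ) : ℝ := avg n (fun t => F t * G t)

lemma ip_add_left (n : ℕ) (F F' G : ℕ → ℝ) :
    ip n (fun t => F t + F' t) G = ip n F G + ip n F' G := by
  simp only [ip, add_mul, avg_add]

lemma ip_sum_left {ι : Type*} (s : Finset ι) (n : ℕ) (F : ι → ℕ → ℝ) (G : ℕ → ℝ) :
    ip n (fun t => ∑ i ∈ s, F i t) G = ∑ i ∈ s, ip n (F i) G := by
  simp only [ip, Finset.sum_mul, avg_sum]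

lemma abs_ip_le (n : ℕ) (F G : ℕ → ℝ) : |ip n F G| ≤ rms n F * rms n G :=
  abs_avg_mul_le_rms n F G

lemma rms_sub_sq (n : ℕ) (F G : ℕ → ℝ) :
    rms n (fun t => F t - G t) ^ 2 = rms n F ^ 2 - 2 * ip n F G + rms n G ^ 2 := by
  simp only [rms_sq, ip]
  rw [← avg_const_mul, ← avg_sub, ← avg_add]
  congr 1
  ext t
  ring

lemma rms_add_sq_le (n : ℕ) (F G : ℕ → ℝ) :
    rms n (fun t => F t + G t) ^ 2 ≤ 2 * rms n F ^ 2 + 2 * rms n G ^ 2 := by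
  simp only [rms_sq]
  rw [← avg_const_mul, ← avg_const_mul, ← avg_add]
  exact avg_mono fun t _ => by nlinarith [sq_nonneg (F t - G t)]

/-- The data `w` are asymptotically orthogonal to all components, uniformly in the frequency
in `[0, π]` and relative to the root mean square of the component. -/
def Negligible (d : ℕ) (w : ℕ → ℕ → ℝ) : Prop :=
  ∀ θ : ℕ → Param, (∀ᶠ n in atTop, (θ n).2.2 ∈ Set.Icc 0 Real.pi) → ∀ ε > 0,
    ∀ᶠ n in atTop, |ip n (w n) (comp d (θ n))| ≤ ε * rms n (comp d (θ n))

lemma Negligible.add {d : ℕ} {w w' : ℕ → ℕ → ℝ} (h : Negligible d w) (h' : Negligible d w') :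
    Negligible d (fun n t => w n t + w' n t) := by
  intro θ hθ ε hε
  filter_upwards [h θ hθ (ε / 2) (by positivity), h' θ hθ (ε / 2) (by positivity)] with n h1 h2
  rw [ip_add_left]
  refine (abs_add_le _ _).trans ?_
  linarith

lemma negligible_zero (d : ℕ) : Negligible d (fun _ _ => 0) := by
  intro θ _ ε hε
  refine Eventually.of_forall fun n => ?_
  have := rms_nonneg n (comp d (θ n))
  simp only [ip, avg, zero_mul, Finset.sum_const_zero, smul_zero, abs_zero]
  positivity

lemma Negligible.sum {d : ℕ} {ι : Type*} (s : Finset ι) {w : ι → ℕ → ℕ → ℝ}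
    (h : ∀ i ∈ s, Negligible d (w i)) : Negligible d (fun n t => ∑ i ∈ s, w i n t) := by
  classical
  induction s using Finset.induction_on with
  | empty => simpa using negligible_zero d
  | insert a s ha ih =>
    simp only [Finset.sum_insert ha]
    exact (h a (Finset.mem_insert_self a s)).add
      (ih fun i hi => h i (Finset.mem_insert_of_mem hi))

lemma negligible_of_rms {d : ℕ} {w : ℕ → ℕ → ℝ} (h : Tendsto (fun n => rms n (w n)) atTop (𝓝 0)) :
    Negligible d w := by
  intro θ _ ε hε
  filter_upwards [h.eventually (ge_mem_nhds hε)] with n hn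
  refine (abs_ip_le _ _ _).trans ?_
  have := rms_nonneg n (comp d (θ n))
  gcongr

lemma avg_ofReal (n : ℕ) (v : ℕ → ℝ) : avg n (fun t => (v t : ℂ)) = ((avg n v : ℝ) : ℂ) := by
  simp [avg]

lemma wave_pi {d : ℕ} (hd : d ≠ 0) (t : ℕ) : wave d Real.pi t = (((-1) ^ t : ℝ) : ℂ) := by
  have hc := comp_add_pi hd 1 0 0 t
  have hs := comp_add_pi hd 0 1 0 t
  simp only [comp, zero_add, zero_mul, Real.cos_zero, Real.sin_zero, mul_one, one_mul, add_zero,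
    mul_zero] at hc hs
  apply Complex.ext
  · rw [wave, re_cis, hc, Complex.ofReal_re]
  · rw [wave, im_cis, hs, Complex.ofReal_im]

lemma tendsto_avg_of_wave_zero {d : ℕ} {l : Filter ℕ} {v : ℕ → ℝ}
    (h : Tendsto (fun n => avg n (fun t => (v t : ℂ) * wave d 0 t)) l (𝓝 0)) :
    Tendsto (fun n => avg n v) l (𝓝 0) := by
  have h1 : ∀ t, wave d 0 t = 1 := fun t => by simp [wave]
  simp only [h1, mul_one, avg_ofReal] at h
  exact (Complex.continuous_re.tendsto _).comp h

lemma tendsto_avg_of_wave_pi {d : ℕ} (hd : d ≠ 0) {l : Filter ℕ} {v : ℕ → ℝ}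
    (h : Tendsto (fun n => avg n (fun t => (v t : ℂ) * wave d Real.pi t)) l (𝓝 0)) :
    Tendsto (fun n => avg n (fun t => (-1) ^ t * v t)) l (𝓝 0) := by
  simp only [wave_pi hd, ← Complex.ofReal_mul, avg_ofReal] at h
  simp only [mul_comm ((-1 : ℝ) ^ _)]
  exact (Complex.continuous_re.tendsto _).comp h

/-- The constant frequencies 0 and π turn the hypothesis into the plain and the alternating averages
needed for slow components. -/
lemma negligible_of_tendsto {d : ℕ} (hd : d = 1 ∨ d = 2) {v : ℕ → ℝ}
    (h : ∀ φ : ℕ → ℝ, Tendsto (fun n => avg n (fun t => (v t : ℂ) * wave d (φ n) t)) atTop (𝓝 0)) :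
    Negligible d (fun _ => v) := by
  intro θ hθ ε hε
  have hd0 : d ≠ 0 := by rcases hd with rfl | rfl <;> norm_num
  exact eventually_abs_avg_mul_comp_le hd le_rfl hθ (h _)
    (tendsto_avg_of_wave_zero (h fun _ => 0)) (tendsto_avg_of_wave_pi hd0 (h fun _ => Real.pi)) hε

end Negligible

/-! ### Resonance between frequencies. -/

section Resonance

/-- Away from the subgroup `R` of frequencies, the averages of waves tend to zero. -/
structure IsResonanceGroup (d : ℕ) (R : AddSubgroup ℝ) : Prop where
  two_pi_mem : 2 * Real.pi ∈ R
  tendsto : ∀ {l : Filter ℕ}, l ≤ atTop → ∀ {φ : ℕ → ℝ} {φ₀ : ℝ}, Tendsto φ l (𝓝 φ₀) → φ₀ ∉ R →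
    Tendsto (fun n => avg n (wave d (φ n))) l (𝓝 0)

lemma ofReal_comp_mul_wave (d : ℕ) (θ : Param) (ψ : ℝ) (t : ℕ) :
    (comp d θ t : ℂ) * wave d ψ t =
      amp θ / 2 * wave d (ψ + θ.2.2) t + conj (amp θ) / 2 * wave d (ψ - θ.2.2) t := by
  have h1 : (comp d θ t : ℂ) =
      (amp θ * wave d θ.2.2 t + conj (amp θ) * wave d (-θ.2.2) t) / 2 := by
    rw [comp_eq_re, Complex.re_eq_add_conj, map_mul, conj_wave]
  rw [h1, sub_eq_add_neg, wave_add, wave_add]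
  ring

lemma avg_comp_mul_wave (n d : ℕ) (θ : Param) (ψ : ℝ) :
    avg n (fun t => (comp d θ t : ℂ) * wave d ψ t) =
      amp θ / 2 * avg n (wave d (ψ + θ.2.2)) + conj (amp θ) / 2 * avg n (wave d (ψ - θ.2.2)) := by
  simp only [ofReal_comp_mul_wave, avg_add, avg_const_mul]

lemma abs_ip_comp_le (n d : ℕ) (θ θ' : Param) :
    2 * |ip n (comp d θ) (comp d θ')| ≤ ‖amp θ‖ * ‖amp θ'‖ *
      (‖avg n (wave d (θ'.2.2 + θ.2.2))‖ + ‖avg n (wave d (θ'.2.2 - θ.2.2))‖) := by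
  have h1 := abs_avg_mul_comp_le_norm n d θ' (comp d θ)
  rw [avg_comp_mul_wave] at h1
  have h2 := norm_add_le (amp θ / 2 * avg n (wave d (θ'.2.2 + θ.2.2)))
    (conj (amp θ) / 2 * avg n (wave d (θ'.2.2 - θ.2.2)))
  rw [norm_mul, norm_mul, norm_div, norm_div, Complex.norm_conj, Complex.norm_ofNat] at h2
  have h3 := mul_le_mul_of_nonneg_left h2 (norm_nonneg (amp θ'))
  rw [ip]
  linarith

variable {d : ℕ} {R : AddSubgroup ℝ}

lemma IsResonanceGroup.tendsto_comp_mul_wave (hR : IsResonanceGroup d R) {l : Filter ℕ}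
    (hl : l ≤ atTop) (θ : Param) {ψ : ℕ → ℝ} {ψ₀ : ℝ} (hψ : Tendsto ψ l (𝓝 ψ₀))
    (hadd : ψ₀ + θ.2.2 ∉ R) (hsub : ψ₀ - θ.2.2 ∉ R) :
    Tendsto (fun n => avg n (fun t => (comp d θ t : ℂ) * wave d (ψ n) t)) l (𝓝 0) := by
  simp only [avg_comp_mul_wave]
  have := ((hR.tendsto hl (hψ.add_const θ.2.2) hadd).const_mul (amp θ / 2)).add
    ((hR.tendsto hl (hψ.sub_const θ.2.2) hsub).const_mul (conj (amp θ) / 2))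
  simpa using this

/-- Apart from nonresonance with ψ₀, the key inequality needs vanishing plain and alternating
averages of the component, that is, no resonance with 0 and π; both follow from 2 `θ.2.2` ∉ R. -/
lemma IsResonanceGroup.eventually_abs_ip_comp_le (hR : IsResonanceGroup d R)
    (hd : d = 1 ∨ d = 2) {l : Filter ℕ} (hl : l ≤ atTop) {θ : Param} (hθ : 2 * θ.2.2 ∉ R)
    {η : ℕ → Param} (hη : ∀ᶠ n in l, (η n).2.2 ∈ Set.Icc 0 Real.pi) {ψ₀ : ℝ}
    (hψ : Tendsto (fun n => (η n).2.2) l (𝓝 ψ₀))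
    (hadd : ψ₀ + θ.2.2 ∉ R) (hsub : ψ₀ - θ.2.2 ∉ R) {ε : ℝ} (hε : 0 < ε) :
    ∀ᶠ n in l, |ip n (comp d θ) (comp d (η n))| ≤ ε * rms n (comp d (η n)) := by
  have hd0 : d ≠ 0 := by rcases hd with rfl | rfl <;> norm_num
  have h0 : θ.2.2 ∉ R := fun h => hθ (by rw [two_mul]; exact R.add_mem h h)
  have hneg : ∀ x : ℝ, x ∈ R → -x ∈ R := fun x hx => R.neg_mem hx
  refine eventually_abs_avg_mul_comp_le hd hl hη (hR.tendsto_comp_mul_wave hl θ hψ hadd hsub)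
    (tendsto_avg_of_wave_zero (d := d) ?_) (tendsto_avg_of_wave_pi hd0 ?_) hε
  · refine hR.tendsto_comp_mul_wave le_rfl θ (tendsto_const_nhds (x := (0 : ℝ))) ?_ ?_
    · rwa [zero_add]
    · rw [zero_sub]; exact fun h => h0 (by simpa using hneg _ h)
  · refine hR.tendsto_comp_mul_wave le_rfl θ (tendsto_const_nhds (x := Real.pi)) ?_ ?_
    · intro h
      apply hθ
      have := R.sub_mem (R.add_mem h h) hR.two_pi_mem
      convert this using 1
      ring
    · intro h
      apply hθ
      have := R.sub_mem hR.two_pi_mem (R.add_mem h h)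
      convert this using 1
      ring

lemma IsResonanceGroup.tendsto_rms_sq (hR : IsResonanceGroup d R) {θ : Param}
    (hθ : 2 * θ.2.2 ∉ R) :
    Tendsto (fun n => rms n (comp d θ) ^ 2) atTop (𝓝 (power θ / 2)) := by
  have h := hR.tendsto le_rfl (tendsto_const_nhds (x := 2 * θ.2.2)) hθ
  have h2 : Tendsto (fun n => (power θ + (amp θ ^ 2 * avg n (wave d (2 * θ.2.2))).re) / 2) atTop
      (𝓝 ((power θ + (amp θ ^ 2 * 0).re) / 2)) :=
    (((Complex.continuous_re.tendsto _).comp (h.const_mul _)).const_add _).div_const _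
  simp only [mul_zero, Complex.zero_re, add_zero] at h2
  refine h2.congr' ?_
  filter_upwards [eventually_ne_atTop 0] with n hn
  rw [rms_comp_sq_eq hn]

/-- The frequencies of the components are interior and pairwise not in resonance. -/
structure IsSeparated (R : AddSubgroup ℝ) {ι : Type*} (K : Finset ι) (θ : ι → Param) : Prop where
  freq : ∀ i ∈ K, (θ i).2.2 ∈ Set.Ioo 0 Real.pi
  two_mul : ∀ i ∈ K, 2 * (θ i).2.2 ∉ R
  add : ∀ i ∈ K, ∀ j ∈ K, i ≠ j → (θ i).2.2 + (θ j).2.2 ∉ R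
  sub : ∀ i ∈ K, ∀ j ∈ K, i ≠ j → (θ i).2.2 - (θ j).2.2 ∉ R

/-- Eliminating ψ from two resonances leaves a resonance between the two components. -/
lemma IsSeparated.eq_of_resonant {ι : Type*} {K : Finset ι} {θ : ι → Param}
    (h : IsSeparated R K θ) {ψ : ℝ} {i j : ι} (hi : i ∈ K) (hj : j ∈ K)
    (hiR : ψ + (θ i).2.2 ∈ R ∨ ψ - (θ i).2.2 ∈ R) (hjR : ψ + (θ j).2.2 ∈ R ∨ ψ - (θ j).2.2 ∈ R) :
    i = j := by
  by_contra hij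
  rcases hiR with h1 | h1 <;> rcases hjR with h2 | h2
  · exact h.sub i hi j hj hij (by convert R.sub_mem h1 h2 using 1; ring)
  · exact h.add i hi j hj hij (by convert R.sub_mem h1 h2 using 1; ring)
  · exact h.add i hi j hj hij (by convert R.sub_mem h2 h1 using 1; ring)
  · exact h.sub i hi j hj hij (by convert R.sub_mem h2 h1 using 1; ring)

end Resonance

/-! ### Consistency of one least squares step. -/

section Consistency

/-- The mean square of the data cancels; only the gain 2⟨z, g⟩ - |g|² of the fitted component g
matters. -/
lemma errorSS_le_iff {d n : ℕ} (hn : n ≠ 0) (z : ℕ → ℝ) (θ θ' : Param) :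
    errorSS (comp d) n z θ ≤ errorSS (comp d) n z θ' ↔
      rms n (comp d θ) ^ 2 - 2 * ip n z (comp d θ) ≤
        rms n (comp d θ') ^ 2 - 2 * ip n z (comp d θ') := by
  have hn0 : (0 : ℝ) < n := by exact_mod_cast Nat.pos_of_ne_zero hn
  have e : ∀ θ : Param, errorSS (comp d) n z θ =
      n * (rms n z ^ 2 + (rms n (comp d θ) ^ 2 - 2 * ip n z (comp d θ))) := by
    intro θ
    have h := rms_sub_sq n z (comp d θ)
    rw [rms_sq] at h
    have h1 : errorSS (comp d) n z θ = n * avg n (fun t => (z t - comp d θ t) ^ 2) := by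
      rw [avg, smul_eq_mul, mul_inv_cancel_left₀ hn0.ne', errorSS]
    rw [h1, h]
    ring
  rw [e, e, mul_le_mul_iff_right₀ hn0, add_le_add_iff_left]

/-- The amplitudes agree, and for t ≤ n the phases differ by at most |φ - ψ| n^d. -/
lemma rms_comp_sub_comp_le (d n : ℕ) (A B φ ψ : ℝ) :
    rms n (fun t => comp d (A, B, φ) t - comp d (A, B, ψ) t) ≤
      ‖amp (A, B, φ)‖ * (|φ - ψ| * (n : ℝ) ^ d) := by
  refine Real.sqrt_le_left (by positivity) |>.2 ?_
  rcases eq_or_ne n 0 with rfl | hn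
  · simp only [avg, Finset.Icc_eq_empty_of_lt zero_lt_one, Finset.sum_empty, smul_zero]
    positivity
  rw [← avg_const hn ((‖amp (A, B, φ)‖ * (|φ - ψ| * (n : ℝ) ^ d)) ^ 2)]
  refine avg_mono fun t ht => ?_
  rw [← sq_abs]
  have htn : (t : ℝ) ≤ n := by exact_mod_cast (Finset.mem_Icc.1 ht).2
  have h1 : amp (A, B, ψ) = amp (A, B, φ) := rfl
  have h2 : ‖wave d φ t - wave d ψ t‖ ≤ |φ - ψ| * (n : ℝ) ^ d := by
    have e : wave d φ t - wave d ψ t = wave d ψ t * (cis ((φ - ψ) * (t : ℝ) ^ d) - 1) := by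
      rw [mul_sub, mul_one, wave, wave, ← cis_add]
      congr 2
      ring
    rw [e, norm_mul, norm_wave, one_mul]
    refine (norm_cis_sub_one_le _).trans ?_
    rw [abs_mul, abs_of_nonneg (by positivity : (0 : ℝ) ≤ (t : ℝ) ^ d)]
    gcongr
  gcongr
  change |comp d (A, B, φ) t - comp d (A, B, ψ) t| ≤ _
  rw [comp_eq_re, comp_eq_re, h1, ← Complex.sub_re, ← mul_sub]
  refine (Complex.abs_re_le_norm _).trans ?_
  rw [norm_mul]
  gcongr

variable {d : ℕ} {R : AddSubgroup ℝ} {ι : Type*} {K : Finset ι} {θ : ι → Param} {i₀ : ι}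
  {w : ℕ → ℕ → ℝ} {η : ℕ → Param}

/-- The minimisation property of the estimators, with the data expanded. -/
lemma eventually_gain_le
    (hmin : ∀ᶠ n in atTop,
      errorSS (comp d) n (fun t => ∑ i ∈ K, comp d (θ i) t + w n t) (η n) ≤
        errorSS (comp d) n (fun t => ∑ i ∈ K, comp d (θ i) t + w n t) (θ i₀)) :
    ∀ᶠ n in atTop, rms n (comp d (η n)) ^ 2 -
        2 * (∑ i ∈ K, ip n (comp d (θ i)) (comp d (η n)) + ip n (w n) (comp d (η n))) ≤
      rms n (comp d (θ i₀)) ^ 2 -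
        2 * (∑ i ∈ K, ip n (comp d (θ i)) (comp d (θ i₀)) + ip n (w n) (comp d (θ i₀))) := by
  filter_upwards [hmin, eventually_ne_atTop 0] with n h hn
  rw [errorSS_le_iff hn] at h
  simpa only [ip_add_left, ip_sum_left] using h

lemma tendsto_ip_negligible_const (hw : Negligible d w) {θ₀ : Param}
    (hθ₀ : θ₀.2.2 ∈ Set.Icc 0 Real.pi) :
    Tendsto (fun n => ip n (w n) (comp d θ₀)) atTop (𝓝 0) := by
  rw [Metric.tendsto_nhds]
  intro ε hε
  have hpos : 0 < ‖amp θ₀‖ + 1 := by positivity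
  filter_upwards [hw (fun _ => θ₀) (Eventually.of_forall fun _ => hθ₀) (ε / (‖amp θ₀‖ + 1))
    (by positivity)] with n hn
  rw [dist_zero_right, Real.norm_eq_abs]
  refine hn.trans_lt ?_
  have h1 := rms_comp_le n d θ₀
  calc ε / (‖amp θ₀‖ + 1) * rms n (comp d θ₀) < ε / (‖amp θ₀‖ + 1) * (‖amp θ₀‖ + 1) := by
        gcongr; linarith
    _ = ε := by field_simp

/-- The fitted components are bounded in mean square. -/
lemma exists_rms_le (hw : Negligible d w) (hη : ∀ᶠ n in atTop, (η n).2.2 ∈ Set.Icc 0 Real.pi)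
    (hi₀ : (θ i₀).2.2 ∈ Set.Icc 0 Real.pi)
    (hmin : ∀ᶠ n in atTop,
      errorSS (comp d) n (fun t => ∑ i ∈ K, comp d (θ i) t + w n t) (η n) ≤
        errorSS (comp d) n (fun t => ∑ i ∈ K, comp d (θ i) t + w n t) (θ i₀)) :
    ∃ G : ℝ, 0 < G ∧ ∀ᶠ n in atTop, rms n (comp d (η n)) ≤ G := by
  set S := ∑ i ∈ K, ‖amp (θ i)‖ with hS
  have hS0 : 0 ≤ S := Finset.sum_nonneg fun i _ => norm_nonneg _
  set a := ‖amp (θ i₀)‖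
  have ha0 : 0 ≤ a := norm_nonneg _
  have hsum : ∀ (n : ℕ) (ζ : Param),
      |∑ i ∈ K, ip n (comp d (θ i)) (comp d ζ)| ≤ S * rms n (comp d ζ) := by
    intro n ζ
    refine (Finset.abs_sum_le_sum_abs _ _).trans ?_
    rw [hS, Finset.sum_mul]
    refine Finset.sum_le_sum fun i _ => (abs_ip_le _ _ _).trans ?_
    have := rms_nonneg n (comp d ζ)
    gcongr
    exact rms_comp_le n d (θ i)
  refine ⟨2 * (S + 1) + a + 1 + 2 * ((S + 1) * a), by positivity, ?_⟩
  filter_upwards [eventually_gain_le hmin, hw η hη 1 one_pos,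
    hw (fun _ => θ i₀) (Eventually.of_forall fun _ => hi₀) 1 one_pos] with n h1 h2 h3
  have h4 := hsum n (η n)
  have h5 := hsum n (θ i₀)
  have h6 := rms_comp_le n d (θ i₀)
  have h7 := rms_nonneg n (comp d (θ i₀))
  have h8 := rms_nonneg n (comp d (η n))
  set g := rms n (comp d (η n))
  set f := rms n (comp d (θ i₀))
  have h9 : f ^ 2 ≤ a ^ 2 := by gcongr
  have h10 : (S + 1) * f ≤ (S + 1) * a := by gcongr
  rw [abs_le] at h2 h3 h4 h5
  -- The data enter the gain linearly in g, so the quadratic term keeps g bounded.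
  have h11 : g ^ 2 ≤ 2 * (S + 1) * g + a ^ 2 + 2 * ((S + 1) * a) := by nlinarith
  by_contra hcon
  push Not at hcon
  have h12 : 0 ≤ (S + 1) * a := by positivity
  nlinarith [mul_nonneg hS0 ha0]

/-- The limit of the gain at the true parameter. -/
lemma tendsto_gain_true (hd : d = 1 ∨ d = 2) (hR : IsResonanceGroup d R) (hK : IsSeparated R K θ)
    (hi₀ : i₀ ∈ K) (hw : Negligible d w) :
    Tendsto (fun n => ip n (w n) (comp d (θ i₀))) atTop (𝓝 0) ∧
    (∀ i ∈ K, i ≠ i₀ → Tendsto (fun n => ip n (comp d (θ i)) (comp d (θ i₀))) atTop (𝓝 0)) ∧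
    Tendsto (fun n => ip n (comp d (θ i₀)) (comp d (θ i₀))) atTop (𝓝 (power (θ i₀) / 2)) := by
  have hIcc := Set.Ioo_subset_Icc_self (hK.freq i₀ hi₀)
  refine ⟨tendsto_ip_negligible_const hw hIcc, fun i hi hne => ?_, ?_⟩
  · rw [Metric.tendsto_nhds]
    intro ε hε
    have hpos : 0 < ‖amp (θ i₀)‖ + 1 := by positivity
    filter_upwards [hR.eventually_abs_ip_comp_le hd le_rfl (hK.two_mul i hi)
      (η := fun _ => θ i₀) (Eventually.of_forall fun _ => hIcc) tendsto_const_nhds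
      (hK.add i₀ hi₀ i hi hne.symm) (hK.sub i₀ hi₀ i hi hne.symm)
      (div_pos hε hpos)] with n hn
    rw [dist_zero_right, Real.norm_eq_abs]
    refine hn.trans_lt ?_
    have h1 := rms_comp_le n d (θ i₀)
    calc ε / (‖amp (θ i₀)‖ + 1) * rms n (comp d (θ i₀))
        < ε / (‖amp (θ i₀)‖ + 1) * (‖amp (θ i₀)‖ + 1) := by gcongr; linarith
      _ = ε := by field_simp
  · refine (hR.tendsto_rms_sq (hK.two_mul i₀ hi₀)).congr fun n => ?_
    rw [rms_sq, ip]
    simp only [sq]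

lemma tendsto_zero_of_eventually_le_mul_rms {l : Filter ℕ} {x : ℕ → ℝ} {G : ℝ} (hG : 0 < G)
    (hbd : ∀ᶠ n in l, rms n (comp d (η n)) ≤ G)
    (h : ∀ ε > 0, ∀ᶠ n in l, |x n| ≤ ε * rms n (comp d (η n))) : Tendsto x l (𝓝 0) := by
  rw [Metric.tendsto_nhds]
  intro ε hε
  filter_upwards [hbd, h (ε / (2 * G)) (by positivity)] with n h1 h2
  rw [dist_zero_right, Real.norm_eq_abs]
  calc |x n| ≤ ε / (2 * G) * rms n (comp d (η n)) := h2
    _ ≤ ε / (2 * G) * G := by gcongr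
    _ = ε / 2 := by field_simp
    _ < ε := by linarith

/-- If the fitted components approach a given one in mean square, so do their parameters. -/
lemma tendsto_of_tendsto_rms_sub (hd : d = 1 ∨ d = 2) (hR : IsResonanceGroup d R) {θ₀ : Param}
    (hfreq : θ₀.2.2 ∈ Set.Ioo 0 Real.pi) (htwo : 2 * θ₀.2.2 ∉ R) (hpos : 0 < power θ₀)
    {l : Filter ℕ} [l.NeBot] (hl : l ≤ atTop) (hη : ∀ᶠ n in l, (η n).2.2 ∈ Set.Icc 0 Real.pi)
    {G : ℝ} (hG : 0 < G) (hbd : ∀ᶠ n in l, rms n (comp d (η n)) ≤ G) {ψ : ℝ}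
    (hψ : Tendsto (fun n => (η n).2.2) l (𝓝 ψ)) (hψI : ψ ∈ Set.Icc 0 Real.pi)
    (hres : ψ + θ₀.2.2 ∈ R ∨ ψ - θ₀.2.2 ∈ R)
    (hrms : Tendsto (fun n => rms n (fun t => comp d θ₀ t - comp d (η n) t)) l (𝓝 0)) :
    Tendsto η l (𝓝 θ₀) := by
  -- Resonance with ψ passes nonresonance of the doubled frequency from θ₀ on to ψ; this will keep
  -- the fitted amplitudes bounded.
  have hψ2 : 2 * ψ ∉ R := by
    intro h
    apply htwo
    rcases hres with h1 | h1
    · convert R.sub_mem (R.add_mem h1 h1) h using 1; ring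
    · convert R.sub_mem h (R.add_mem h1 h1) using 1; ring
  have he := (hR.tendsto hl (hψ.const_mul 2) hψ2).norm
  rw [norm_zero] at he
  set a₀ := ‖amp θ₀‖ with ha₀
  have ha₀sq : a₀ ^ 2 = power θ₀ := norm_amp_sq θ₀
  have ha₀pos : 0 < a₀ := by
    rcases (norm_nonneg (amp θ₀)).eq_or_lt with h | h
    · rw [← ha₀sq, ha₀, ← h] at hpos; norm_num at hpos
    · exact h
  set a : ℕ → ℝ := fun n => ‖amp (η n)‖ with ha
  set e : ℕ → ℝ := fun n => ‖avg n (wave d (2 * (η n).2.2))‖ with hedef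
  have habd : ∀ᶠ n in l, a n ≤ 2 * G := by
    filter_upwards [he.eventually (ge_mem_nhds (by norm_num : (0 : ℝ) < 1 / 2)), hbd,
      hl (eventually_ne_atTop 0)] with n h1 h2 hn
    have h3 := power_mul_le_rms_sq hn d (η n)
    rw [← norm_amp_sq] at h3
    change a n ^ 2 * (1 - e n) ≤ _ at h3
    have h4 : 0 ≤ rms n (comp d (η n)) := rms_nonneg _ _
    have h5 : e n ≤ 1 / 2 := h1
    refine abs_le_of_sq_le_sq' ?_ (by positivity) |>.2
    nlinarith [sq_nonneg (a n)]
  set Ep : ℕ → ℝ := fun n => ‖avg n (wave d ((η n).2.2 + θ₀.2.2))‖ with hEp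
  set Em : ℕ → ℝ := fun n => ‖avg n (wave d ((η n).2.2 - θ₀.2.2))‖ with hEm
  have hEp1 : ∀ n, 0 ≤ Ep n ∧ Ep n ≤ 1 := fun n => ⟨norm_nonneg _, norm_avg_wave_le _ _ _⟩
  have hEm1 : ∀ n, 0 ≤ Em n ∧ Em n ≤ 1 := fun n => ⟨norm_nonneg _, norm_avg_wave_le _ _ _⟩
  -- Write a for `a n` and E for Ep + Em. Up to vanishing terms, twice the squared distance is at
  -- least a₀² - 2a₀aE + a² = (a - a₀E)² + a₀²(1 - E²). Here δ collects the resulting bound for 1 -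
  -- E².
  set δ : ℕ → ℝ := fun n => (a₀ ^ 2 - 2 * rms n (comp d θ₀) ^ 2 +
    2 * rms n (fun t => comp d θ₀ t - comp d (η n) t) ^ 2 + (2 * G) ^ 2 * e n) / a₀ ^ 2 with hδ
  have hδ0 : Tendsto δ l (𝓝 0) := by
    have h1 := ((hR.tendsto_rms_sq htwo).mono_left hl).const_mul 2
    have h2 := (((h1.const_sub (a₀ ^ 2)).add ((hrms.pow 2).const_mul 2)).add
      (he.const_mul ((2 * G) ^ 2))).div_const (a₀ ^ 2)
    convert h2 using 2
    rw [ha₀sq]; ring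
  have hF : ∀ᶠ n in l, 1 - (Ep n + Em n) ^ 2 ≤ δ n := by
    filter_upwards [habd, hl (eventually_ne_atTop 0)] with n h1 hn
    have h2 := power_mul_le_rms_sq hn d (η n)
    rw [← norm_amp_sq] at h2
    change a n ^ 2 * (1 - e n) ≤ _ at h2
    have h3 := abs_ip_comp_le n d θ₀ (η n)
    change _ ≤ a₀ * a n * (Ep n + Em n) at h3
    have h4 := rms_sub_sq n (comp d θ₀) (comp d (η n))
    have h5 := le_abs_self (ip n (comp d θ₀) (comp d (η n)))
    have he0 : 0 ≤ e n := norm_nonneg _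
    have ha0 : 0 ≤ a n := norm_nonneg _
    have h6 : a n ^ 2 * e n ≤ (2 * G) ^ 2 * e n := by gcongr
    simp only [hδ]
    rw [le_div_iff₀ (by positivity)]
    nlinarith [sq_nonneg (a₀ * (Ep n + Em n) - a n)]
  have hdevlim : ∀ (χ : ℕ → ℝ) (x : ℕ → ℝ), Tendsto x l (𝓝 0) →
      (∀ᶠ n in l, 1 - ‖avg n (wave d (χ n))‖ ^ 2 ≤ δ n + 3 * x n) →
      Tendsto (fun n => waveDev d (χ n) n) l (𝓝 0) := by
    intro χ x hx h
    have h1 : Tendsto (fun n => √(δ n + 3 * x n)) l (𝓝 0) := by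
      have := (Real.continuous_sqrt.tendsto _).comp (hδ0.add (hx.const_mul 3))
      simpa [Function.comp_def] using this
    refine tendsto_of_tendsto_of_tendsto_of_le_of_le' tendsto_const_nhds h1
      (Eventually.of_forall fun n => waveDev_nonneg _ _ _) ?_
    filter_upwards [h] with n hn
    exact Real.sqrt_le_sqrt hn
  -- Otherwise Em vanishes, Ep tends to one, and rigidity puts ψ + `θ₀.2.2` into 2πℤ, although it
  -- lies strictly between 0 and 2π.
  have hminus : ψ + θ₀.2.2 ∉ R := by
    intro hplus
    have hsub : ψ - θ₀.2.2 ∉ R := by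
      intro h
      apply htwo
      convert R.sub_mem hplus h using 1; ring
    have hEm0 := (hR.tendsto hl (hψ.sub_const θ₀.2.2) hsub).norm
    rw [norm_zero] at hEm0
    have hdev := hdevlim (fun n => (η n).2.2 + θ₀.2.2) Em hEm0 (by
      filter_upwards [hF] with n hn
      change 1 - Ep n ^ 2 ≤ _
      nlinarith [hEp1 n, hEm1 n])
    have h1 : Tendsto (fun n => ‖cis ((η n).2.2 + θ₀.2.2) - 1‖) l (𝓝 0) := by
      refine tendsto_of_tendsto_of_tendsto_of_le_of_le' tendsto_const_nhds
        (by simpa using hdev.const_mul 24) (Eventually.of_forall fun n => norm_nonneg _) ?_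
      filter_upwards [hl (eventually_ge_atTop 4)] with n hn
      exact norm_cis_sub_one_le_waveDev hd _ hn
    have h2 : Tendsto (fun n => ‖cis ((η n).2.2 + θ₀.2.2) - 1‖) l (𝓝 ‖cis (ψ + θ₀.2.2) - 1‖) :=
      (((continuous_cis.tendsto _).comp (hψ.add_const _)).sub_const 1).norm
    have h3 := tendsto_nhds_unique h2 h1
    rw [norm_eq_zero, sub_eq_zero, cis_eq_one_iff] at h3
    obtain ⟨k, hk⟩ := h3
    have hpi := Real.pi_pos
    have hk0 : (0 : ℝ) < k := by
      by_contra hcon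
      push Not at hcon
      nlinarith [hψI.1, hfreq.1]
    have hk1 : (k : ℝ) < 1 := by
      by_contra hcon
      push Not at hcon
      nlinarith [hψI.2, hfreq.2]
    have hk0' : 0 < k := by exact_mod_cast hk0
    have hk1' : k < 1 := by exact_mod_cast hk1
    omega
  have hEp0 := (hR.tendsto hl (hψ.add_const θ₀.2.2) hminus).norm
  rw [norm_zero] at hEp0
  have hdev := hdevlim (fun n => (η n).2.2 - θ₀.2.2) Ep hEp0 (by
    filter_upwards [hF] with n hn
    change 1 - Em n ^ 2 ≤ _
    nlinarith [hEp1 n, hEm1 n])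
  -- Now Ep vanishes, so Em tends to one, and rigidity gives the frequency error with its rate
  -- o(n^{-d}).
  have hscaled : Tendsto (fun n : ℕ => |(η n).2.2 - θ₀.2.2| * (n : ℝ) ^ d) l (𝓝 0) := by
    refine tendsto_of_tendsto_of_tendsto_of_le_of_le' tendsto_const_nhds
      (by simpa using hdev.const_mul 700) (Eventually.of_forall fun n => by positivity) ?_
    filter_upwards [hl (eventually_ge_atTop 4), hη,
      hdev.eventually (ge_mem_nhds (by norm_num : (0 : ℝ) < 1 / 24))] with n hn h1 h2
    refine abs_mul_pow_le_waveDev hd hn ?_ h2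
    rw [abs_le]
    constructor <;> linarith [h1.1, h1.2, hfreq.1, hfreq.2]
  have hφ : Tendsto (fun n => (η n).2.2) l (𝓝 θ₀.2.2) := by
    rw [tendsto_iff_norm_sub_tendsto_zero]
    refine tendsto_of_tendsto_of_tendsto_of_le_of_le' tendsto_const_nhds hscaled
      (Eventually.of_forall fun n => norm_nonneg _) ?_
    filter_upwards [hl (eventually_ge_atTop 1)] with n hn
    rw [Real.norm_eq_abs]
    have : (1 : ℝ) ≤ (n : ℝ) ^ d := one_le_pow₀ (by exact_mod_cast hn)
    nlinarith [abs_nonneg ((η n).2.2 - θ₀.2.2)]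
  have hE0 := ((hR.tendsto le_rfl (tendsto_const_nhds (x := 2 * θ₀.2.2)) htwo).norm).mono_left hl
  rw [norm_zero] at hE0
  -- By that rate, replacing the fitted frequency by the true one costs o(1) in mean square. The
  -- difference is then a component with the single frequency `θ₀.2.2`, whose amplitudes its root
  -- mean square controls.
  set D : ℕ → Param := fun n => (θ₀.1 - (η n).1, θ₀.2.1 - (η n).2.1, θ₀.2.2) with hD
  have hpow : Tendsto (fun n => power (D n)) l (𝓝 0) := by
    have h1 : Tendsto (fun n => 4 * (2 * rms n (fun t => comp d θ₀ t - comp d (η n) t) ^ 2 +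
        2 * (2 * G * (|(η n).2.2 - θ₀.2.2| * (n : ℝ) ^ d)) ^ 2)) l (𝓝 0) := by
      have := (((hrms.pow 2).const_mul 2).add (((hscaled.const_mul (2 * G)).pow 2).const_mul 2))
      simpa using this.const_mul 4
    refine tendsto_of_tendsto_of_tendsto_of_le_of_le' tendsto_const_nhds h1
      (Eventually.of_forall fun n => by rw [← norm_amp_sq]; positivity) ?_
    filter_upwards [hE0.eventually (ge_mem_nhds (by norm_num : (0 : ℝ) < 1 / 2)), habd,
      hl (eventually_ne_atTop 0)] with n h2 h3 hn
    have h4 := power_mul_le_rms_sq hn d (D n)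
    have h5 : rms n (comp d (D n)) ^ 2 ≤
        2 * rms n (fun t => comp d θ₀ t - comp d (η n) t) ^ 2 +
        2 * rms n (fun t => comp d ((η n).1, (η n).2.1, (η n).2.2) t -
          comp d ((η n).1, (η n).2.1, θ₀.2.2) t) ^ 2 := by
      refine le_trans (le_of_eq ?_) (rms_add_sq_le n _ _)
      congr 2
      ext t
      simp only [comp, hD]
      ring
    have h6 := rms_comp_sub_comp_le d n (η n).1 (η n).2.1 (η n).2.2 θ₀.2.2
    have h7 : rms n (fun t => comp d ((η n).1, (η n).2.1, (η n).2.2) t -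
          comp d ((η n).1, (η n).2.1, θ₀.2.2) t) ^ 2 ≤
        (2 * G * (|(η n).2.2 - θ₀.2.2| * (n : ℝ) ^ d)) ^ 2 := by
      have := rms_nonneg n (fun t => comp d ((η n).1, (η n).2.1, (η n).2.2) t -
          comp d ((η n).1, (η n).2.1, θ₀.2.2) t)
      have h8 : ‖amp ((η n).1, (η n).2.1, (η n).2.2)‖ ≤ 2 * G := h3
      gcongr
      exact h6.trans (by gcongr)
    have h9 : 0 ≤ power (D n) := by rw [← norm_amp_sq]; positivity
    have h10 : power (D n) * (1 / 2) ≤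
        power (D n) * (1 - ‖avg n (wave d (2 * (D n).2.2))‖) := by
      gcongr
      change 1 / 2 ≤ 1 - ‖avg n (wave d (2 * θ₀.2.2))‖
      linarith
    linarith
  have hcoord : ∀ x : ℕ → ℝ, ∀ y : ℝ, (∀ n, (y - x n) ^ 2 ≤ power (D n)) →
      Tendsto x l (𝓝 y) := by
    intro x y hxy
    have h1 : Tendsto (fun n => (y - x n) ^ 2) l (𝓝 0) :=
      squeeze_zero (fun n => sq_nonneg _) hxy hpow
    have h2 : Tendsto (fun n => |y - x n|) l (𝓝 0) := by
      have := (Real.continuous_sqrt.tendsto _).comp h1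
      simpa [Function.comp_def, Real.sqrt_sq_eq_abs] using this
    rw [tendsto_iff_norm_sub_tendsto_zero]
    refine h2.congr fun n => ?_
    rw [Real.norm_eq_abs, abs_sub_comm]
  have hA := hcoord (fun n => (η n).1) θ₀.1 fun n => by
    simp only [power, hD]; linarith [sq_nonneg (θ₀.2.1 - (η n).2.1)]
  have hB := hcoord (fun n => (η n).2.1) θ₀.2.1 fun n => by
    simp only [power, hD]; linarith [sq_nonneg (θ₀.1 - (η n).1)]
  exact hA.prodMk_nhds (hB.prodMk_nhds hφ)

/-- Consistency of the least squares estimator of the strongest of finitely many components in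
negligible noise. -/
theorem tendsto_lse (hd : d = 1 ∨ d = 2) (hR : IsResonanceGroup d R) (hK : IsSeparated R K θ)
    (hi₀ : i₀ ∈ K) (hpow : ∀ i ∈ K, i ≠ i₀ → power (θ i) < power (θ i₀))
    (hpos : 0 < power (θ i₀)) (hw : Negligible d w)
    (hη : ∀ᶠ n in atTop, (η n).2.2 ∈ Set.Icc 0 Real.pi)
    (hmin : ∀ᶠ n in atTop,
      errorSS (comp d) n (fun t => ∑ i ∈ K, comp d (θ i) t + w n t) (η n) ≤
        errorSS (comp d) n (fun t => ∑ i ∈ K, comp d (θ i) t + w n t) (θ i₀)) :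
    Tendsto η atTop (𝓝 (θ i₀)) ∧
      Tendsto (fun n => rms n (fun t => comp d (θ i₀) t - comp d (η n) t)) atTop (𝓝 0) := by
  classical
  have hIcc := Set.Ioo_subset_Icc_self (hK.freq i₀ hi₀)
  obtain ⟨G, hG, hbd⟩ := exists_rms_le hw hη hIcc hmin
  have hgain := eventually_gain_le hmin
  obtain ⟨hw0, hoff0, hdiag0⟩ := tendsto_gain_true hd hR hK hi₀ hw
  -- Along an ultrafilter the fitted frequencies converge by compactness, with no subsequences to
  -- extract.
  suffices H : ∀ U : Ultrafilter ℕ, (U : Filter ℕ) ≤ atTop →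
      Tendsto η U (𝓝 (θ i₀)) ∧
      Tendsto (fun n => rms n (fun t => comp d (θ i₀) t - comp d (η n) t)) U (𝓝 0) from
    ⟨tendsto_iff_ultrafilter _ _ _ |>.2 fun U hU => (H U hU).1,
      tendsto_iff_ultrafilter _ _ _ |>.2 fun U hU => (H U hU).2⟩
  intro U hU
  obtain ⟨ψ, hψI, hψ⟩ : ∃ ψ ∈ Set.Icc 0 Real.pi, Tendsto (fun n => (η n).2.2) U (𝓝 ψ) := by
    have := isCompact_Icc.ultrafilter_le_nhds (U.map fun n => (η n).2.2)
      (le_principal_iff.2 (hU hη))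
    exact this
  have hwη : Tendsto (fun n => ip n (w n) (comp d (η n))) U (𝓝 0) :=
    tendsto_zero_of_eventually_le_mul_rms hG (hU hbd) fun ε hε => hU (hw η hη ε hε)
  have hnon : ∀ i ∈ K, ¬ (ψ + (θ i).2.2 ∈ R ∨ ψ - (θ i).2.2 ∈ R) →
      Tendsto (fun n => ip n (comp d (θ i)) (comp d (η n))) U (𝓝 0) := by
    intro i hi hres
    rw [not_or] at hres
    exact tendsto_zero_of_eventually_le_mul_rms hG (hU hbd) fun ε hε =>
      hR.eventually_abs_ip_comp_le hd hU (hK.two_mul i hi) (hU hη) hψ hres.1 hres.2 hε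
  have htrue : Tendsto (fun n => 2 * (∑ i ∈ K, ip n (comp d (θ i)) (comp d (θ i₀)) +
      ip n (w n) (comp d (θ i₀))) - rms n (comp d (θ i₀)) ^ 2) U (𝓝 (power (θ i₀) / 2)) := by
    have h1 : Tendsto (fun n => ∑ i ∈ K, ip n (comp d (θ i)) (comp d (θ i₀))) atTop
        (𝓝 (∑ i ∈ K, if i = i₀ then power (θ i₀) / 2 else 0)) := by
      refine tendsto_finsetSum _ fun i hi => ?_
      by_cases h : i = i₀
      · subst h; simpa using hdiag0
      · simpa [h] using hoff0 i hi h
    rw [Finset.sum_ite_eq' K i₀, if_pos hi₀] at h1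
    have h2 := ((h1.add hw0).const_mul 2).sub (hR.tendsto_rms_sq (hK.two_mul i₀ hi₀))
    convert h2.mono_left hU using 2
    ring
  -- Here u is the part of the data term that survives and b bounds the gain it leaves. The fit
  -- gains at least as much as the true parameter, whose gain tends to half its power.
  have hcontra : ∀ (u b : ℕ → ℝ) (β : ℝ),
      Tendsto (fun n => 2 * ∑ i ∈ K, ip n (comp d (θ i)) (comp d (η n)) - u n) U (𝓝 0) →
      Tendsto b U (𝓝 β) → (∀ n, u n - rms n (comp d (η n)) ^ 2 ≤ b n) →
      power (θ i₀) / 2 ≤ β := by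
    intro u b β hu hb hub
    have h1 := (hu.add (hwη.const_mul 2)).add hb
    rw [mul_zero, zero_add, zero_add] at h1
    refine le_of_tendsto_of_tendsto htrue h1 ?_
    filter_upwards [hU hgain] with n hn
    have := hub n
    linarith
  -- If ψ resonates with another component k, completing the square bounds the gain by the mean
  -- square of k, half a smaller power in the limit; if with none, the gain is asymptotically at
  -- most 0.
  have hres : ψ + (θ i₀).2.2 ∈ R ∨ ψ - (θ i₀).2.2 ∈ R := by
    by_contra hres
    by_cases hex : ∃ k ∈ K, ψ + (θ k).2.2 ∈ R ∨ ψ - (θ k).2.2 ∈ R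
    · obtain ⟨k, hk, hkres⟩ := hex
      have hne : k ≠ i₀ := by rintro rfl; exact hres hkres
      have h1 := hcontra (fun n => 2 * ip n (comp d (θ k)) (comp d (η n)))
        (fun n => rms n (comp d (θ k)) ^ 2) (power (θ k) / 2) ?_
        ((hR.tendsto_rms_sq (hK.two_mul k hk)).mono_left hU) ?_
      · linarith [hpow k hk hne]
      · have h2 : Tendsto (fun n => 2 * ∑ i ∈ K.erase k, ip n (comp d (θ i)) (comp d (η n))) U
            (𝓝 (2 * ∑ i ∈ K.erase k, 0)) := by
          refine (tendsto_finsetSum _ fun i hi => ?_).const_mul 2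
          obtain ⟨hik, hiK⟩ := Finset.mem_erase.1 hi
          exact hnon i hiK fun h => hik (hK.eq_of_resonant hiK hk h hkres)
        rw [Finset.sum_const_zero, mul_zero] at h2
        refine h2.congr fun n => ?_
        rw [← Finset.add_sum_erase K _ hk]
        ring
      · intro n
        have := sq_nonneg (rms n (fun t => comp d (θ k) t - comp d (η n) t))
        rw [rms_sub_sq] at this
        linarith
    · push Not at hex
      have h1 := hcontra (fun _ => 0) (fun _ => 0) 0 ?_ tendsto_const_nhds ?_
      · linarith
      · have h2 : Tendsto (fun n => 2 * ∑ i ∈ K, ip n (comp d (θ i)) (comp d (η n)) - 0) U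
            (𝓝 (2 * ∑ i ∈ K, 0 - 0)) := by
          refine ((tendsto_finsetSum _ fun i hi => ?_).const_mul 2).sub_const 0
          exact hnon i hi fun h => h.elim (hex i hi).1 (hex i hi).2
        simpa using h2
      · intro n
        linarith [sq_nonneg (rms n (comp d (η n)))]
  -- With i₀ the only resonant component, the minimising inequality bounds the squared distance by
  -- cross terms that vanish.
  have hrms : Tendsto (fun n => rms n (fun t => comp d (θ i₀) t - comp d (η n) t)) U (𝓝 0) := by
    have h1 : Tendsto (fun n => ∑ i ∈ K.erase i₀, ip n (comp d (θ i)) (comp d (η n))) U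
        (𝓝 (∑ i ∈ K.erase i₀, 0)) := by
      refine tendsto_finsetSum _ fun i hi => ?_
      obtain ⟨hii, hiK⟩ := Finset.mem_erase.1 hi
      exact hnon i hiK fun h => hii (hK.eq_of_resonant hiK hi₀ h hres)
    have h2 : Tendsto (fun n => ∑ i ∈ K.erase i₀, ip n (comp d (θ i)) (comp d (θ i₀))) U
        (𝓝 (∑ i ∈ K.erase i₀, 0)) := by
      refine tendsto_finsetSum _ fun i hi => ?_
      obtain ⟨hii, hiK⟩ := Finset.mem_erase.1 hi
      exact (hoff0 i hiK hii).mono_left hU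
    have h3 := (((h1.add hwη).sub h2).sub (hw0.mono_left hU)).const_mul 2
    rw [Finset.sum_const_zero, add_zero, sub_zero, sub_zero, mul_zero] at h3
    have h4 : Tendsto (fun n => rms n (fun t => comp d (θ i₀) t - comp d (η n) t) ^ 2) U
        (𝓝 0) := by
      refine tendsto_of_tendsto_of_tendsto_of_le_of_le' tendsto_const_nhds h3
        (Eventually.of_forall fun n => sq_nonneg _) ?_
      filter_upwards [hU hgain] with n hn
      rw [← Finset.add_sum_erase K _ hi₀, ← Finset.add_sum_erase K _ hi₀] at hn
      rw [rms_sub_sq]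
      have h5 : ip n (comp d (θ i₀)) (comp d (θ i₀)) = rms n (comp d (θ i₀)) ^ 2 := by
        rw [rms_sq, ip]; simp only [sq]
      rw [h5] at hn
      linarith
    have h5 := (Real.continuous_sqrt.tendsto _).comp h4
    simpa [Function.comp_def, Real.sqrt_sq (rms_nonneg _ _)] using h5
  exact ⟨tendsto_of_tendsto_rms_sub hd hR (hK.freq i₀ hi₀) (hK.two_mul i₀ hi₀) hpos hU (hU hη) hG
    (hU hbd) hψ hψI hres hrms, hrms⟩

end Consistency

/-! ### The resonance groups of sinusoids and chirps. -/

section ResonanceGroups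

lemma isResonanceGroup_linear :
    IsResonanceGroup 1 (AddSubgroup.zmultiples (2 * Real.pi)) where
  two_pi_mem := AddSubgroup.mem_zmultiples _
  tendsto hl _ _ hφ h₀ := tendsto_avg_linear hl hφ fun h => by
    obtain ⟨k, hk⟩ := (cis_eq_one_iff _).1 h
    exact h₀ (AddSubgroup.mem_zmultiples_iff.2 ⟨k, by rw [hk, zsmul_eq_mul]⟩)

/-- The rational multiples of `π`. -/
noncomputable def rationalPi : AddSubgroup ℝ :=
  ((AddMonoidHom.mulRight Real.pi).comp (Rat.castHom ℝ).toAddMonoidHom).range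

lemma mem_rationalPi {x : ℝ} : x ∈ rationalPi ↔ ¬ Irrational (x / Real.pi) := by
  rw [rationalPi, AddMonoidHom.mem_range, Irrational, not_not, Set.mem_range]
  refine exists_congr fun r => ?_
  rw [eq_div_iff Real.pi_ne_zero]
  rfl

lemma isResonanceGroup_quadratic : IsResonanceGroup 2 rationalPi where
  two_pi_mem := by
    rw [mem_rationalPi, mul_div_cancel_right₀ _ Real.pi_ne_zero]
    exact not_irrational_ofNat 2
  tendsto hl φ _ hφ h₀ := by
    have := tendsto_avg_quadratic hl (fun _ => 0) hφ (not_not.1 fun h => h₀ (mem_rationalPi.2 h))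
    refine this.congr fun n => ?_
    congr 1
    ext t
    simp [wave]

lemma freq_mem_Ioo {M : ℝ} {θ : Param} (h : θ ∈ interior (paramSpace M)) :
    θ.2.2 ∈ Set.Ioo 0 Real.pi := by
  rw [paramSpace, interior_prod_eq, interior_prod_eq, interior_Icc, interior_Icc] at h
  exact h.2.2

lemma paramSpace_subset (M : ℝ) : paramSpace M ⊆ freeAmplitudeSpace :=
  Set.prod_mono (Set.subset_univ _) (Set.prod_mono (Set.subset_univ _) subset_rfl)

/-- Sums and differences of numbers in (0, π) have modulus below 2π, so they are multiples of 2π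
only if they vanish. -/
lemma isSeparated_sinusoid {m : ℕ} {M : ℝ} {θ : Fin m → Param} (h : IsInteriorDistinct M θ)
    (K : Finset (Fin m)) : IsSeparated (AddSubgroup.zmultiples (2 * Real.pi)) K θ := by
  have hpi := Real.pi_pos
  have hf : ∀ i, (θ i).2.2 ∈ Set.Ioo 0 Real.pi := fun i => freq_mem_Ioo (h.interior i)
  have key : ∀ x : ℝ, x ∈ AddSubgroup.zmultiples (2 * Real.pi) → |x| < 2 * Real.pi → x = 0 := by
    intro x hx hlt
    obtain ⟨k, rfl⟩ := AddSubgroup.mem_zmultiples_iff.1 hx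
    rw [zsmul_eq_mul, abs_mul, abs_of_pos (by positivity : 0 < 2 * Real.pi)] at hlt
    have h1 : |(k : ℝ)| < 1 := by
      by_contra hcon
      push Not at hcon
      nlinarith
    have h2 : |k| < 1 := by exact_mod_cast h1
    rw [Int.abs_lt_one_iff] at h2
    simp [h2]
  refine ⟨fun i _ => hf i, fun i _ hi => ?_, fun i _ j _ hij hi => ?_, fun i _ j _ hij hi => ?_⟩
  · have := key _ hi (by rw [abs_lt]; constructor <;> linarith [(hf i).1, (hf i).2])
    linarith [(hf i).1]
  · have := key _ hi (by
      rw [abs_lt]; constructor <;> linarith [(hf i).1, (hf i).2, (hf j).1, (hf j).2])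
    linarith [(hf i).1, (hf j).1]
  · have := key _ hi (by
      rw [abs_lt]; constructor <;> linarith [(hf i).1, (hf i).2, (hf j).1, (hf j).2])
    exact hij (h.distinct (sub_eq_zero.1 this))

lemma isSeparated_chirp {m : ℕ} {M : ℝ} {θ : Fin m → Param} (h : IsInteriorDistinct M θ)
    (hr : HasGenericRates θ) (K : Finset (Fin m)) : IsSeparated rationalPi K θ where
  freq i _ := freq_mem_Ioo (h.interior i)
  two_mul i _ hi := by
    rw [mem_rationalPi, mul_div_assoc] at hi
    apply hi
    exact_mod_cast (hr.rate i).natCast_mul (m := 2) two_ne_zero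
  add i _ j _ hij hi := mem_rationalPi.1 hi (hr.add i j hij)
  sub i _ j _ hij hi := mem_rationalPi.1 hi (hr.sub i j hij)

/-- Chirps with irrational rate are negligible for the fit of sinusoids. -/
lemma negligible_chirp {θ : Param} (h : Irrational (θ.2.2 / Real.pi)) :
    Negligible 1 (fun _ => chirp θ) := by
  rw [chirp_eq_comp]
  refine negligible_of_tendsto (Or.inl rfl) fun φ => ?_
  have hneg : Irrational (-θ.2.2 / Real.pi) := by
    rw [neg_div]; exact h.neg
  have h1 := ((tendsto_avg_quadratic le_rfl φ (tendsto_const_nhds (x := θ.2.2)) h).const_mul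
    (amp θ / 2)).add ((tendsto_avg_quadratic le_rfl φ (tendsto_const_nhds (x := -θ.2.2))
      hneg).const_mul (conj (amp θ) / 2))
  rw [mul_zero, mul_zero, add_zero] at h1
  refine h1.congr fun n => ?_
  rw [← avg_const_mul, ← avg_const_mul, ← avg_add]
  congr 1
  ext t
  rw [comp_eq_re, Complex.re_eq_add_conj, map_mul, conj_wave, cis_add, cis_add]
  simp only [wave, pow_one]
  ring

end ResonanceGroups

/-! ### The sequential procedure. -/

section Sequential

/-- Consistency of the sequential procedure within one family of components. -/
theorem tendsto_sequential {d : ℕ} (hd : d = 1 ∨ d = 2) {R : AddSubgroup ℝ}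
    (hR : IsResonanceGroup d R) {m : ℕ} {θ : Fin m → Param}
    (hsep : ∀ K : Finset (Fin m), IsSeparated R K θ) (hpow : HasDecreasingPower θ)
    {S : Set Param} (hS : S ⊆ freeAmplitudeSpace) (hθS : ∀ j, θ j ∈ S)
    {w : ℕ → ℕ → ℝ} (hw : Negligible d w) {est : ℕ → Fin m → Param}
    (hest : ∀ᶠ n in atTop, ∀ j, IsLSE S (comp d) n (fun t => ∑ i, comp d (θ i) t + w n t -
      ∑ i ∈ Finset.Iio j, comp d (est n i) t) (est n j)) (j : Fin m) :
    Tendsto (fun n => est n j) atTop (𝓝 (θ j)) ∧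
      Tendsto (fun n => rms n (fun t => comp d (θ j) t - comp d (est n j) t)) atTop (𝓝 0) := by
  induction j using WellFoundedLT.induction with
  | _ j ih =>
  -- The induction carries convergence in mean square along: convergence of the parameters without a
  -- rate would not make the errors of the removed components negligible.
  have hw' : Negligible d (fun n t =>
      ∑ i ∈ Finset.Iio j, (comp d (θ i) t - comp d (est n i) t) + w n t) :=
    (Negligible.sum (Finset.Iio j) (w := fun i n t => comp d (θ i) t - comp d (est n i) t)
      fun i hi => negligible_of_rms (ih i (Finset.mem_Iio.1 hi)).2).add hw
  have hz : ∀ n, (fun t => ∑ i, comp d (θ i) t + w n t -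
      ∑ i ∈ Finset.Iio j, comp d (est n i) t) = fun t => ∑ i ∈ Finset.Ici j, comp d (θ i) t +
      (∑ i ∈ Finset.Iio j, (comp d (θ i) t - comp d (est n i) t) + w n t) := by
    intro n
    ext t
    have hsplit : ∑ i, comp d (θ i) t =
        ∑ i ∈ Finset.Iio j, comp d (θ i) t + ∑ i ∈ Finset.Ici j, comp d (θ i) t := by
      rw [← Finset.sum_union]
      · congr 1
        ext i
        simp [lt_or_ge]
      · rw [Finset.disjoint_left]
        intro i h1 h2
        exact absurd (Finset.mem_Iio.1 h1) (not_lt.2 (Finset.mem_Ici.1 h2))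
    rw [hsplit, Finset.sum_sub_distrib]
    ring
  refine tendsto_lse hd hR (hsep (Finset.Ici j)) (Finset.mem_Ici.2 le_rfl) (fun i hi hne => ?_)
    (hpow.pos j) hw' ?_ ?_
  · exact hpow.strictAnti (lt_of_le_of_ne (Finset.mem_Ici.1 hi) (Ne.symm hne))
  · filter_upwards [hest] with n hn
    exact (hS (hn j).1).2.2
  · filter_upwards [hest] with n hn
    have := (hn j).2
    rw [hz] at this
    exact isMinOn_iff.1 this _ (hθS j)

/-- Consistency of the sequential least squares estimators along a path on which the noise is
uncorrelated with all sinusoids and chirps. -/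
theorem tendsto_sequentialLSE {p q : ℕ} {M : ℝ} {θ₁ : Fin p → Param} {θ₂ : Fin q → Param}
    (hθ₁ : IsInteriorDistinct M θ₁) (hθ₂ : IsInteriorDistinct M θ₂)
    (hpow₁ : HasDecreasingPower θ₁) (hpow₂ : HasDecreasingPower θ₂)
    (hrates : HasGenericRates θ₂) {S : Set Param}
    (hS : S = paramSpace M ∨ S = freeAmplitudeSpace) {x : ℕ → ℝ}
    (hx : ∀ d, d = 1 ∨ d = 2 → ∀ φ : ℕ → ℝ,
      Tendsto (fun n => avg n (fun t => (x t : ℂ) * wave d (φ n) t)) atTop (𝓝 0))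
    {est₁ : ℕ → Fin p → Param} {est₂ : ℕ → Fin q → Param}
    (hest : ∀ᶠ n in atTop, IsSequentialLSE S n
      (fun t => ∑ j, sinusoid (θ₁ j) t + ∑ k, chirp (θ₂ k) t + x t) (est₁ n) (est₂ n)) :
    (∀ j, Tendsto (fun n => est₁ n j) atTop (𝓝 (θ₁ j))) ∧
      ∀ k, Tendsto (fun n => est₂ n k) atTop (𝓝 (θ₂ k)) := by
  have hSfree : S ⊆ freeAmplitudeSpace := by
    rcases hS with rfl | rfl
    · exact paramSpace_subset M
    · exact subset_rfl
  have hSpar : paramSpace M ⊆ S := by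
    rcases hS with rfl | rfl
    · exact subset_rfl
    · exact paramSpace_subset M
  have h1 := tendsto_sequential (Or.inl rfl) isResonanceGroup_linear (isSeparated_sinusoid hθ₁)
    hpow₁ hSfree (fun j => hSpar (interior_subset (hθ₁.interior j)))
    (w := fun _ t => ∑ k, chirp (θ₂ k) t + x t) (est := est₁)
    ((Negligible.sum Finset.univ (w := fun k _ => chirp (θ₂ k))
      fun k _ => negligible_chirp (hrates.rate k)).add
      (negligible_of_tendsto (Or.inl rfl) (hx 1 (Or.inl rfl)))) (by
    filter_upwards [hest] with n hn j
    have := hn.sinusoid_step j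
    rw [sinusoid_eq_comp] at this
    convert this using 1
    ext t
    rw [sinusoidResidual, sinusoid_eq_comp]
    ring)
  refine ⟨fun j => (h1 j).1, fun k => (tendsto_sequential (Or.inr rfl) isResonanceGroup_quadratic
    (isSeparated_chirp hθ₂ hrates) hpow₂ hSfree
    (fun j => hSpar (interior_subset (hθ₂.interior j)))
    (w := fun n t => ∑ j, (sinusoid (θ₁ j) t - sinusoid (est₁ n j) t) + x t)
    (est := est₂) ?_ ?_ k).1⟩
  -- Orthogonality of sinusoids to chirps is not needed, since the errors of the fitted sinusoids
  -- are already small in mean square.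
  · refine (Negligible.sum Finset.univ
      (w := fun j n t => sinusoid (θ₁ j) t - sinusoid (est₁ n j) t) fun j _ =>
      negligible_of_rms ?_).add (negligible_of_tendsto (Or.inr rfl) (hx 2 (Or.inr rfl)))
    rw [sinusoid_eq_comp]
    exact (h1 j).2
  · filter_upwards [hest] with n hn k
    have := hn.chirp_step k
    rw [chirp_eq_comp] at this
    convert this using 1
    ext t
    rw [chirpResidual, chirp_eq_comp, Finset.sum_sub_distrib]
    ring

end Sequential

/-! ### Cesàro limits along residue classes. -/

section Residues

lemma sum_range_mul (z : ℕ → ℝ) (M q : ℕ) :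
    ∑ t ∈ Finset.range (M * q), z t =
      ∑ r ∈ Finset.range M, ∑ s ∈ Finset.range q, z (M * s + r) := by
  induction q with
  | zero => simp
  | succ q ih =>
    rw [Nat.mul_succ, Finset.sum_range_add, ih, ← Finset.sum_add_distrib]
    simp [Finset.sum_range_succ]

/-- A sequence has Cesàro limit zero if it does along each residue class. -/
lemma tendsto_cesaro_of_residues {z : ℕ → ℝ} {M : ℕ} (hM : 0 < M)
    (h : ∀ r < M,
      Tendsto (fun n : ℕ => (∑ s ∈ Finset.range n, z (M * s + r)) / n) atTop (𝓝 0)) :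
    Tendsto (fun n : ℕ => (∑ t ∈ Finset.range n, z t) / n) atTop (𝓝 0) := by
  -- A single term is a difference of consecutive partial sums, hence o(q); such terms fill the
  -- incomplete last block.
  have hlast : ∀ r < M, Tendsto (fun q : ℕ => |z (M * q + r)| / q) atTop (𝓝 0) := by
    intro r hr
    have h1 := ((h r hr).comp (tendsto_add_atTop_nat 1)).mul
      ((tendsto_inv_atTop_nhds_zero_nat (𝕜 := ℝ)).const_add 1)
    have h2 := (h1.sub (h r hr)).abs
    simp only [add_zero, mul_one, sub_zero, abs_zero] at h2
    refine h2.congr' ?_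
    filter_upwards [eventually_gt_atTop 0] with q hq
    have hq' : (0 : ℝ) < q := by exact_mod_cast hq
    have e : (z (M * q + r)) / q = ((∑ s ∈ Finset.range (q + 1), z (M * s + r)) / (q + 1 : ℕ)) *
        (1 + (q : ℝ)⁻¹) - (∑ s ∈ Finset.range q, z (M * s + r)) / q := by
      rw [Finset.sum_range_succ]
      push_cast
      field_simp
      ring
    rw [← abs_of_pos hq', ← abs_div, abs_of_pos hq', e]
    rfl
  have hq : Tendsto (fun n : ℕ => n / M) atTop atTop := Nat.tendsto_div_const_atTop hM.ne'
  have hB : Tendsto (fun q : ℕ => ∑ r ∈ Finset.range M,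
      (|(∑ s ∈ Finset.range q, z (M * s + r)) / q| + |z (M * q + r)| / q)) atTop (𝓝 0) := by
    have := tendsto_finsetSum (Finset.range M) fun r hr =>
      ((h r (Finset.mem_range.1 hr)).abs.add (hlast r (Finset.mem_range.1 hr)))
    simpa using this
  refine squeeze_zero_norm' ?_ (hB.comp hq)
  filter_upwards [eventually_ge_atTop M] with n hn
  set q := n / M with hqdef
  have hq0 : 0 < q := Nat.div_pos hn hM
  have hq' : (0 : ℝ) < q := by exact_mod_cast hq0
  have hqn : (q : ℝ) ≤ n := by exact_mod_cast Nat.div_le_self n M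
  have hsplit : ∑ t ∈ Finset.range n, z t = ∑ r ∈ Finset.range M, ∑ s ∈ Finset.range q,
      z (M * s + r) + ∑ r ∈ Finset.range (n % M), z (M * q + r) := by
    rw [← sum_range_mul, ← Finset.sum_range_add, hqdef, Nat.div_add_mod]
  have h1 : |∑ t ∈ Finset.range n, z t| ≤ ∑ r ∈ Finset.range M,
      (|∑ s ∈ Finset.range q, z (M * s + r)| + |z (M * q + r)|) := by
    rw [hsplit, Finset.sum_add_distrib]
    refine (abs_add_le _ _).trans (add_le_add (Finset.abs_sum_le_sum_abs _ _)
      ((Finset.abs_sum_le_sum_abs _ _).trans ?_))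
    exact Finset.sum_le_sum_of_subset_of_nonneg
      (Finset.range_mono (Nat.mod_lt n hM).le) fun _ _ _ => abs_nonneg _
  rw [norm_div, Real.norm_eq_abs, Real.norm_natCast]
  calc |∑ t ∈ Finset.range n, z t| / n ≤ |∑ t ∈ Finset.range n, z t| / q := by gcongr
    _ ≤ (∑ r ∈ Finset.range M,
        (|∑ s ∈ Finset.range q, z (M * s + r)| + |z (M * q + r)|)) / q := by gcongr
    _ = _ := by
      rw [Finset.sum_div]
      refine Finset.sum_congr rfl fun r _ => ?_
      rw [add_div, abs_div, Nat.abs_cast]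

lemma avg_eq_sum_range_div (f : ℕ → ℝ) (n : ℕ) :
    avg n f = (∑ t ∈ Finset.range n, f (t + 1)) / n := by
  have : ∑ t ∈ Finset.Icc 1 n, f t = ∑ t ∈ Finset.range n, f (t + 1) := by
    induction n with
    | zero => simp
    | succ n ih => rw [Finset.sum_Icc_succ_top (by omega), ih, Finset.sum_range_succ]
  rw [avg, smul_eq_mul, this, div_eq_inv_mul]

end Residues

/-! ### Noise against linear and quadratic phases. -/

section Uncorrelated

/-- In a correlation of translates a linear phase becomes a factor independent of t, so only the
correlations of x itself matter. -/
lemma tendsto_avg_mul_cis_linear {x : ℕ → ℝ} {C : ℝ}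
    (hC : ∀ n : ℕ, ∑ t ∈ Finset.Icc 1 n, x t ^ 2 ≤ C * n)
    (hx : ∀ h k, h ≠ k → Tendsto (fun n => avg n (fun t => x (t + h) * x (t + k))) atTop (𝓝 0))
    (α : ℕ → ℝ) : Tendsto (fun n => avg n (fun t => (x t : ℂ) * cis (α n * t))) atTop (𝓝 0) := by
  refine tendsto_avg_of_correlations (x := fun n t => (x t : ℂ) * cis (α n * t)) le_rfl
    (v := fun t => |x t|) (C := C) (fun n t => by simp) (fun n => by simpa using hC n) ?_
  intro h k hhk
  have e : ∀ n t : ℕ, (x (t + h) : ℂ) * cis (α n * (t + h : ℕ)) *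
      conj ((x (t + k) : ℂ) * cis (α n * (t + k : ℕ))) =
      cis (α n * (h - k)) * ((x (t + h) * x (t + k) : ℝ) : ℂ) := by
    intro n t
    have : cis (α n * (h - k)) = cis (α n * (t + h : ℕ)) * cis (-(α n * (t + k : ℕ))) := by
      rw [← cis_add]
      congr 1
      push_cast
      ring
    rw [this, map_mul, conj_cis, Complex.conj_ofReal]
    push_cast
    ring
  simp only [e, avg_const_mul, avg_ofReal]
  rw [tendsto_zero_iff_norm_tendsto_zero]
  simpa using (hx h k hhk).norm

/-- The sample moments of `x` which control its correlation with linear and quadratic phases. -/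
structure IsUncorrelated (x : ℕ → ℝ) : Prop where
  sq : ∃ C : ℝ, ∀ n : ℕ, ∑ t ∈ Finset.Icc 1 n, x t ^ 2 ≤ C * n
  two : ∀ h k, h < k → Tendsto (fun n => avg n (fun t => x (t + h) * x (t + k))) atTop (𝓝 0)
  sq_two : ∀ h k, h < k → ∃ C : ℝ, ∀ n : ℕ,
    ∑ t ∈ Finset.Icc 1 n, (x (t + h) * x (t + k)) ^ 2 ≤ C * n
  four : ∀ h k i j, h < k → i < j → Tendsto (fun n => avg n (fun t =>
    x (t + i + h) * x (t + i + k) * (x (t + j + h) * x (t + j + k)))) atTop (𝓝 0)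

/-- Van der Corput once for a linear phase, with `two`. For a quadratic phase one differencing
leaves products x (t + h) x (t + k) with linear phases, and a second one is governed by `sq_two` and
`four`. -/
theorem IsUncorrelated.tendsto_avg_mul_wave {x : ℕ → ℝ} (hx : IsUncorrelated x) {d : ℕ}
    (hd : d = 1 ∨ d = 2) (φ : ℕ → ℝ) :
    Tendsto (fun n => avg n (fun t => (x t : ℂ) * wave d (φ n) t)) atTop (𝓝 0) := by
  obtain ⟨C, hC⟩ := hx.sq
  rcases hd with rfl | rfl
  · have htwo : ∀ h k, h ≠ k →
        Tendsto (fun n => avg n (fun t => x (t + h) * x (t + k))) atTop (𝓝 0) := by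
      intro h k hhk
      rcases lt_or_gt_of_ne hhk with h1 | h1
      · exact hx.two h k h1
      · simpa only [mul_comm] using hx.two k h h1
    simpa only [wave, pow_one] using tendsto_avg_mul_cis_linear hC htwo φ
  · have hlin : ∀ h k, h < k → ∀ α : ℕ → ℝ, Tendsto (fun n => avg n (fun t =>
        ((x (t + h) * x (t + k) : ℝ) : ℂ) * cis (α n * t))) atTop (𝓝 0) := by
      intro h k hhk
      obtain ⟨C', hC'⟩ := hx.sq_two h k hhk
      refine tendsto_avg_mul_cis_linear hC' fun i j hij => ?_
      rcases lt_or_gt_of_ne hij with h1 | h1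
      · exact hx.four h k i j hhk h1
      · have := hx.four h k j i hhk h1
        refine this.congr fun n => ?_
        congr 1
        ext t
        ring
    refine tendsto_avg_of_correlations (x := fun n t => (x t : ℂ) * wave 2 (φ n) t) le_rfl
      (v := fun t => |x t|) (C := C) (fun n t => by simp) (fun n => by simpa using hC n) ?_
    intro h k hhk
    have e : ∀ n t : ℕ, (x (t + h) : ℂ) * wave 2 (φ n) (t + h) *
        conj ((x (t + k) : ℂ) * wave 2 (φ n) (t + k)) =
        cis (φ n * ((h : ℝ) ^ 2 - (k : ℝ) ^ 2)) * (((x (t + h) * x (t + k) : ℝ) : ℂ) *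
          cis (2 * ((h : ℝ) - k) * φ n * t)) := by
      intro n t
      have : cis (φ n * ((h : ℝ) ^ 2 - (k : ℝ) ^ 2)) * cis (2 * ((h : ℝ) - k) * φ n * t) =
          wave 2 (φ n) (t + h) * conj (wave 2 (φ n) (t + k)) := by
        rw [wave, wave, conj_cis, ← cis_add, ← cis_add]
        congr 1
        push_cast
        ring
      rw [mul_left_comm, this, map_mul, Complex.conj_ofReal]
      push_cast
      ring
    simp only [e, avg_const_mul]
    have hlim : Tendsto (fun n => avg n (fun t => ((x (t + h) * x (t + k) : ℝ) : ℂ) *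
        cis (2 * ((h : ℝ) - k) * φ n * t))) atTop (𝓝 0) := by
      rcases lt_or_gt_of_ne hhk with h1 | h1
      · exact hlin h k h1 _
      · have := hlin k h h1 (fun n => 2 * ((h : ℝ) - k) * φ n)
        simpa only [mul_comm (x (_ + h))] using this
    rw [tendsto_zero_iff_norm_tendsto_zero] at hlim ⊢
    simpa using hlim

lemma exists_sum_le_of_tendsto_avg {f : ℕ → ℝ} {L : ℝ}
    (h : Tendsto (fun n => avg n f) atTop (𝓝 L)) :
    ∃ C : ℝ, ∀ n : ℕ, ∑ t ∈ Finset.Icc 1 n, f t ≤ C * n := by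
  obtain ⟨C, hC⟩ := h.bddAbove_range
  refine ⟨C, fun n => ?_⟩
  rcases Nat.eq_zero_or_pos n with rfl | hn
  · simp
  have hn' : (0 : ℝ) < n := by exact_mod_cast hn
  have := hC ⟨n, rfl⟩
  simp only [avg, smul_eq_mul] at this
  rw [inv_mul_le_iff₀ hn'] at this
  linarith

end Uncorrelated

/-! ### Sample moments of i.i.d. variables. -/

section IID

variable {Ω : Type*} [MeasurableSpace Ω] {μ : Measure Ω}

/-- The strong law of large numbers for functions of a window of i.i.d. random variables. -/
theorem ae_tendsto_avg_window {v : ℕ → Ω → ℝ} (hm : ∀ t, Measurable (v t)) (hind : iIndepFun v μ)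
    (hid : ∀ s t, IdentDistrib (v s) (v t) μ μ) {m : ℕ} {F : (Fin m → ℝ) → ℝ} (hF : Measurable F)
    (hint : Integrable (fun ω => F (fun i => v i ω)) μ) :
    ∀ᵐ ω ∂μ, Tendsto (fun n => avg n (fun t => F (fun i => v (t + i) ω))) atTop
      (𝓝 (∫ ω, F (fun i => v i ω) ∂μ)) := by
  set L := ∫ ω, F (fun i => v i ω) ∂μ with hL
  have hident : ∀ s t : ℕ, IdentDistrib (fun ω => F (fun i => v (s + i) ω))
      (fun ω => F (fun i => v (t + i) ω)) μ μ := by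
    intro s t
    have hinj : ∀ s : ℕ, Function.Injective fun i : Fin m => s + (i : ℕ) := by
      intro s i j hij
      exact Fin.ext (by simpa using hij)
    exact (IdentDistrib.pi (X := fun (i : Fin m) => v (s + i)) (Y := fun (i : Fin m) => v (t + i))
      (fun i => hid _ _) (hind.precomp (hinj s)) (hind.precomp (hinj t))).comp hF
  have hindep : ∀ s t : ℕ, s + m ≤ t → IndepFun (fun ω => F (fun i => v (s + i) ω))
      (fun ω => F (fun i => v (t + i) ω)) μ := by
    intro s t hst
    have hdisj : Disjoint (Finset.Ico s (s + m)) (Finset.Ico t (t + m)) := by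
      rw [Finset.disjoint_left]
      intro i hi hi'
      rw [Finset.mem_Ico] at hi hi'
      omega
    have h1 := hind.indepFun_finset _ _ hdisj hm
    have hmem : ∀ (s : ℕ) (i : Fin m), s + (i : ℕ) ∈ Finset.Ico s (s + m) := by
      intro s i
      rw [Finset.mem_Ico]
      have := i.2
      omega
    have hmeas : ∀ s : ℕ, Measurable fun x : Finset.Ico s (s + m) → ℝ =>
        F (fun i => x ⟨s + i, hmem s i⟩) := fun s =>
      hF.comp (measurable_pi_lambda _ fun i => measurable_pi_apply _)
    exact h1.comp (hmeas s) (hmeas t)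
  -- Windows of length m starting m + 1 apart are disjoint, so along a residue class the terms are
  -- pairwise independent, which the strong law requires. The step m + 1 is positive even for m = 0.
  have hslln : ∀ r : ℕ, ∀ᵐ ω ∂μ, Tendsto (fun n : ℕ => (∑ s ∈ Finset.range n,
      F (fun i => v ((m + 1) * s + r + 1 + i) ω)) / n) atTop (𝓝 L) := by
    intro r
    have h := strong_law_ae_real (μ := μ)
      (fun s ω => F (fun i => v ((m + 1) * s + r + 1 + i) ω))
      ((hident ((m + 1) * 0 + r + 1) 0).integrable_iff.2 (by simpa using hint)) ?_
      (fun i => hident _ _)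
    · have hLr : ∫ ω, F (fun i => v ((m + 1) * 0 + r + 1 + i) ω) ∂μ = L := by
        rw [(hident ((m + 1) * 0 + r + 1) 0).integral_eq, hL]
        simp
      rwa [hLr] at h
    · intro s t hst
      have key : ∀ s t : ℕ, s < t → (m + 1) * s + r + 1 + m ≤ (m + 1) * t + r + 1 := by
        intro s t hst
        have : (m + 1) * (s + 1) ≤ (m + 1) * t := Nat.mul_le_mul_left _ hst
        rw [Nat.mul_succ] at this
        omega
      rcases lt_or_gt_of_ne hst with h1 | h1
      · exact hindep _ _ (key s t h1)
      · exact (hindep _ _ (key t s h1)).symm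
  filter_upwards [ae_all_iff.2 hslln] with ω hω
  have h0 := tendsto_cesaro_of_residues (z := fun t => F (fun i => v (t + 1 + i) ω) - L)
    (M := m + 1) (Nat.succ_pos m) (fun r _ => by
      have := (hω r).sub_const L
      rw [sub_self] at this
      refine this.congr' ?_
      filter_upwards [eventually_ne_atTop 0] with n hn
      have hn' : (n : ℝ) ≠ 0 := by exact_mod_cast hn
      rw [Finset.sum_sub_distrib, sub_div]
      congr 1
      simp [hn'])
  have h1 := h0.add_const L
  rw [zero_add] at h1
  refine h1.congr' ?_
  filter_upwards [eventually_ne_atTop 0] with n hn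
  have hn' : (n : ℝ) ≠ 0 := by exact_mod_cast hn
  rw [avg_eq_sum_range_div, Finset.sum_sub_distrib, sub_div]
  simp [hn']

/-- Almost all paths of centred i.i.d. random variables with finite variance have vanishing sample
correlations. -/
theorem ae_isUncorrelated [IsProbabilityMeasure μ] {v : ℕ → Ω → ℝ} (hm : ∀ t, Measurable (v t))
    (hind : iIndepFun v μ) (hid : ∀ s t, IdentDistrib (v s) (v t) μ μ)
    (hL2 : ∀ t, MemLp (v t) 2 μ) (hmean : ∀ t, ∫ ω, v t ω ∂μ = 0) :
    ∀ᵐ ω ∂μ, IsUncorrelated (fun t => v t ω) := by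
  have hint1 : ∀ t, Integrable (v t) μ := fun t => (hL2 t).integrable one_le_two
  have hint2 : ∀ s t, Integrable (v s * v t) μ := fun s t => (hL2 s).integrable_mul (hL2 t)
  have hsqint : ∀ t, Integrable (fun ω => v t ω ^ 2) μ := fun t => (hL2 t).integrable_sq
  have h1 : ∀ᵐ ω ∂μ, ∃ C : ℝ, ∀ n : ℕ, ∑ t ∈ Finset.Icc 1 n, v t ω ^ 2 ≤ C * n := by
    filter_upwards [ae_tendsto_avg_window hm hind hid (m := 1) (F := fun x => x 0 ^ 2)
      (by fun_prop) (by simpa using hsqint 0)] with ω hω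
    simpa using exists_sum_le_of_tendsto_avg hω
  have h2 : ∀ h k, h < k → ∀ᵐ ω ∂μ,
      Tendsto (fun n => avg n (fun t => v (t + h) ω * v (t + k) ω)) atTop (𝓝 0) := by
    intro h k hhk
    have h0 : ∫ ω, v h ω * v k ω ∂μ = 0 := by
      rw [(hind.indepFun hhk.ne).integral_fun_mul_eq_mul_integral (hm h).aestronglyMeasurable
        (hm k).aestronglyMeasurable, hmean, zero_mul]
    have := ae_tendsto_avg_window hm hind hid (m := k + 1)
      (F := fun x => x ⟨h, by omega⟩ * x ⟨k, by omega⟩) (by fun_prop) (hint2 h k)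
    simpa only [h0] using this
  have h3 : ∀ h k, h < k → ∀ᵐ ω ∂μ, ∃ C : ℝ, ∀ n : ℕ,
      ∑ t ∈ Finset.Icc 1 n, (v (t + h) ω * v (t + k) ω) ^ 2 ≤ C * n := by
    intro h k hhk
    -- Independence makes this fourth-order product integrable with second moments only.
    have hi : Integrable (fun ω => (v h ω * v k ω) ^ 2) μ := by
      have hind2 : IndepFun (fun ω => v h ω ^ 2) (fun ω => v k ω ^ 2) μ :=
        (hind.indepFun hhk.ne).comp (φ := fun x : ℝ => x ^ 2) (ψ := fun x : ℝ => x ^ 2)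
          (by fun_prop) (by fun_prop)
      have := hind2.integrable_mul (hsqint h) (hsqint k)
      refine this.congr (Eventually.of_forall fun ω => ?_)
      simp [mul_pow]
    filter_upwards [ae_tendsto_avg_window hm hind hid (m := k + 1)
      (F := fun x => (x ⟨h, by omega⟩ * x ⟨k, by omega⟩) ^ 2) (by fun_prop) hi] with ω hω
    exact exists_sum_le_of_tendsto_avg hω
  have h4 : ∀ h k i j, h < k → i < j → ∀ᵐ ω ∂μ, Tendsto (fun n => avg n (fun t =>
      v (t + i + h) ω * v (t + i + k) ω * (v (t + j + h) ω * v (t + j + k) ω))) atTop (𝓝 0) := by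
    intro h k i j hhk hij
    -- Only i + k = j + h can coincide among the four indices, so second moments again suffice. The
    -- index i + h is strictly the smallest, and its centred factor is independent of the rest.
    have hrest : Integrable (v (j + k) * (v (i + k) * v (j + h))) μ :=
      (hind.indepFun_mul_left hm (i + k) (j + h) (j + k) (by omega) (by omega)).symm.integrable_mul
        (hint1 _) (hint2 _ _)
    have hindep : IndepFun (v (i + h)) (v (j + k) * (v (i + k) * v (j + h))) μ := by
      have hdisj : Disjoint {i + h} (Finset.Ico (i + h + 1) (j + k + 1)) := by
        rw [Finset.disjoint_singleton_left, Finset.mem_Ico]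
        omega
      have hφ : Measurable fun x : ({i + h} : Finset ℕ) → ℝ =>
          x ⟨i + h, Finset.mem_singleton_self _⟩ := by fun_prop
      have hψ : Measurable fun x : Finset.Ico (i + h + 1) (j + k + 1) → ℝ =>
          x ⟨j + k, by rw [Finset.mem_Ico]; omega⟩ *
            (x ⟨i + k, by rw [Finset.mem_Ico]; omega⟩ *
              x ⟨j + h, by rw [Finset.mem_Ico]; omega⟩) := by fun_prop
      exact (hind.indepFun_finset _ _ hdisj hm).comp hφ hψ
    have e : ∀ ω, v (i + h) ω * v (i + k) ω * (v (j + h) ω * v (j + k) ω) =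
        (v (i + h) * (v (j + k) * (v (i + k) * v (j + h)))) ω := by
      intro ω
      simp only [Pi.mul_apply]
      ring
    have hi : Integrable
        (fun ω => v (i + h) ω * v (i + k) ω * (v (j + h) ω * v (j + k) ω)) μ := by
      simp only [e]
      exact hindep.integrable_mul (hint1 _) hrest
    have h0 : ∫ ω, v (i + h) ω * v (i + k) ω * (v (j + h) ω * v (j + k) ω) ∂μ = 0 := by
      simp only [e]
      rw [hindep.integral_mul_eq_mul_integral (hm _).aestronglyMeasurable
        hrest.aestronglyMeasurable, hmean, zero_mul]
    have := ae_tendsto_avg_window hm hind hid (m := j + k + 1)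
      (F := fun x => x ⟨i + h, by omega⟩ * x ⟨i + k, by omega⟩ *
        (x ⟨j + h, by omega⟩ * x ⟨j + k, by omega⟩)) (by fun_prop) hi
    simpa only [h0, ← add_assoc] using this
  have h2' := ae_all_iff.2 fun h => ae_all_iff.2 fun k => ae_all_iff.2 (h2 h k)
  have h3' := ae_all_iff.2 fun h => ae_all_iff.2 fun k => ae_all_iff.2 (h3 h k)
  have h4' := ae_all_iff.2 fun h => ae_all_iff.2 fun k => ae_all_iff.2 fun i =>
    ae_all_iff.2 fun j => ae_all_iff.2 fun hhk => ae_all_iff.2 (h4 h k i j hhk)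
  filter_upwards [h1, h2', h3', h4'] with ω g1 g2 g3 g4
  exact ⟨g1, g2, g3, g4⟩

end IID

/-! ### From the innovations to the linear process. -/

section LinearProcess

variable {Ω : Type*} [MeasurableSpace Ω] {μ : Measure Ω}

/-- Averages of nonnegative numbers are controlled by the dyadic ones. -/
lemma avg_le_of_dyadic {f : ℕ → ℝ} (hf : ∀ t, 0 ≤ f t) {B : ℝ}
    (hB : ∀ k : ℕ, avg (2 ^ k) f ≤ B) (n : ℕ) : avg n f ≤ 2 * B := by
  have hB0 : 0 ≤ B := (avg_nonneg hf).trans (hB 0)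
  rcases Nat.eq_zero_or_pos n with rfl | hn
  · simpa [avg] using hB0
  have hn' : (0 : ℝ) < n := by exact_mod_cast hn
  set k := Nat.log 2 n + 1 with hk
  have h1 : n ≤ 2 ^ k := (Nat.lt_pow_succ_log_self one_lt_two n).le
  have h2 : ((2 ^ k : ℕ) : ℝ) ≤ 2 * n := by
    have : 2 ^ k ≤ 2 * n := by
      rw [hk, pow_succ, mul_comm]
      exact Nat.mul_le_mul_left 2 (Nat.pow_log_le_self 2 hn.ne')
    exact_mod_cast this
  have hp : (0 : ℝ) < (2 ^ k : ℕ) := by positivity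
  have h3 := hB k
  rw [avg, smul_eq_mul, inv_mul_le_iff₀ hp] at h3
  rw [avg, smul_eq_mul, inv_mul_le_iff₀ hn']
  calc ∑ t ∈ Finset.Icc 1 n, f t ≤ ∑ t ∈ Finset.Icc 1 (2 ^ k), f t :=
        Finset.sum_le_sum_of_subset_of_nonneg (Finset.Icc_subset_Icc le_rfl h1) fun i _ _ => hf i
    _ ≤ (2 ^ k : ℕ) * B := h3
    _ ≤ 2 * n * B := by gcongr
    _ = _ := by ring

/-- The dyadic mean square deviations of the averages of `|v|`, summed, have finite expectation. -/
lemma lintegral_tsum_dyadic_le [IsProbabilityMeasure μ] {v : ℕ → Ω → ℝ}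
    (hm : ∀ t, Measurable (v t)) (hind : iIndepFun v μ)
    (hid : ∀ s t, IdentDistrib (v s) (v t) μ μ) (hL2 : ∀ t, MemLp (v t) 2 μ) :
    ∫⁻ ω, ∑' k : ℕ, ‖avg (2 ^ k) (fun t => |v t ω|) - ∫ ω, |v 0 ω| ∂μ‖ₑ ^ 2 ∂μ ≤
      ENNReal.ofReal (2 * variance (fun ω => |v 0 ω|) μ) := by
  have habs : ∀ t, MemLp (fun ω => |v t ω|) 2 μ := fun t => (hL2 t).abs
  have hid' : ∀ t, IdentDistrib (fun ω => |v t ω|) (fun ω => |v 0 ω|) μ μ := fun t =>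
    (hid t 0).comp (u := fun x : ℝ => |x|) (by fun_prop)
  set V := variance (fun ω => |v 0 ω|) μ with hV
  have hV0 : 0 ≤ V := variance_nonneg _ _
  have hmeas : ∀ k : ℕ, Measurable fun ω => avg (2 ^ k) (fun t => |v t ω|) := by
    intro k
    simp only [avg]
    fun_prop
  rw [lintegral_tsum fun k => (((hmeas k).sub_const _).enorm.pow_const 2).aemeasurable]
  have hk : ∀ k : ℕ, ∫⁻ ω, ‖avg (2 ^ k) (fun t => |v t ω|) - ∫ ω, |v 0 ω| ∂μ‖ₑ ^ 2 ∂μ =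
      ENNReal.ofReal (V * (1 / 2) ^ k) := by
    intro k
    set n := 2 ^ k with hn
    have hn0 : (n : ℝ) ≠ 0 := by positivity
    have hAe : (fun ω => avg n (fun t => |v t ω|)) =
        fun ω => (n : ℝ)⁻¹ * (∑ t ∈ Finset.Icc 1 n, fun ω => |v t ω|) ω := by
      ext ω
      simp [avg]
    have hsum : MemLp (∑ t ∈ Finset.Icc 1 n, fun ω => |v t ω|) 2 μ :=
      memLp_finsetSum' _ fun t _ => habs t
    have hA2 : MemLp (fun ω => avg n (fun t => |v t ω|)) 2 μ := by
      rw [hAe]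
      exact hsum.const_mul _
    have hmean : ∫ ω, avg n (fun t => |v t ω|) ∂μ = ∫ ω, |v 0 ω| ∂μ := by
      simp only [avg, smul_eq_mul]
      rw [integral_const_mul, integral_finsetSum _ fun t _ => (habs t).integrable one_le_two,
        Finset.sum_congr rfl fun t _ => (hid' t).integral_eq]
      simp [hn0]
    -- An average of 2^k independent terms has variance V/2^k, and these sum to 2V over k.
    have hvar : variance (fun ω => avg n (fun t => |v t ω|)) μ = V * (1 / 2) ^ k := by
      rw [hAe, variance_const_mul, IndepFun.variance_sum (fun t _ => habs t),
        Finset.sum_congr rfl fun t _ => (hid' t).variance_eq]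
      · simp only [Finset.sum_const, Nat.card_Icc, Nat.add_sub_cancel, nsmul_eq_mul, ← hV]
        rw [hn]
        push_cast
        rw [one_div_pow]
        have hp : (2 : ℝ) ^ k ≠ 0 := by positivity
        generalize (2 : ℝ) ^ k = y at hp
        field_simp
      · intro s _ t _ hst
        exact (hind.indepFun hst).comp (φ := fun x : ℝ => |x|) (ψ := fun x : ℝ => |x|)
          (by fun_prop) (by fun_prop)
    rw [← hvar, hA2.ofReal_variance_eq, evariance, hmean]
  simp only [hk]
  have hsumm : Summable fun k : ℕ => V * (1 / 2 : ℝ) ^ k := summable_geometric_two.mul_left V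
  rw [← ENNReal.ofReal_tsum_of_nonneg (fun k => by positivity) hsumm, tsum_mul_left,
    tsum_geometric_two, mul_comm]

/-- Almost all paths of a linear process have vanishing sample correlation with linear and quadratic
phases, uniformly in the frequency. -/
theorem ae_tendsto_avg_linearProcess [IsProbabilityMeasure μ] {e : ℤ → Ω → ℝ} {a : ℤ → ℝ} {σ : ℝ}
    {X : ℤ → Ω → ℝ} (hX : IsLinearProcess μ e a σ X) :
    ∀ᵐ ω ∂μ, ∀ d, d = 1 ∨ d = 2 → ∀ φ : ℕ → ℝ,
      Tendsto (fun n => avg n (fun t => (X t ω : ℂ) * wave d (φ n) t)) atTop (𝓝 0) := by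
  have hinj : ∀ j : ℤ, Function.Injective fun t : ℕ => (t : ℤ) - j := by
    intro j s t hst
    simpa using hst
  have hunc : ∀ j : ℤ, ∀ᵐ ω ∂μ, IsUncorrelated (fun t : ℕ => e (t - j) ω) := fun j =>
    ae_isUncorrelated (v := fun t : ℕ => e (t - j)) (fun t => hX.measurable _)
      (hX.indep.precomp (hinj j)) (fun s t => hX.identDistrib _ _) (fun t => hX.memLp _)
      (fun t => hX.mean _)
  have hidabs : ∀ t, IdentDistrib (fun ω => |e t ω|) (fun ω => |e 0 ω|) μ μ := fun t =>
    (hX.identDistrib t 0).comp (u := fun x : ℝ => |x|) (by fun_prop)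
  set m₁ := ∫ ω, |e 0 ω| ∂μ with hm₁
  set V := variance (fun ω => |e 0 ω|) μ with hV
  -- On a given path the averages of |e| need not be bounded uniformly in the shift j. The
  -- expectation of N j is, so ∑ |a j| N j is almost surely finite and yields a summable majorant.
  set N : ℤ → Ω → ENNReal := fun j ω =>
    ∑' k : ℕ, ‖avg (2 ^ k) (fun t : ℕ => |e (t - j) ω|) - m₁‖ₑ ^ 2 with hN
  have hNmeas : ∀ j, Measurable (N j) := by
    intro j
    refine Measurable.tsum fun k => ?_
    have : Measurable fun ω => avg (2 ^ k) (fun t : ℕ => |e (t - j) ω|) := by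
      simp only [avg]
      have := hX.measurable
      fun_prop
    fun_prop
  have hNle : ∀ j, ∫⁻ ω, N j ω ∂μ ≤ ENNReal.ofReal (2 * V) := by
    intro j
    have := lintegral_tsum_dyadic_le (v := fun t : ℕ => e (t - j)) (fun t => hX.measurable _)
      (hX.indep.precomp (hinj j)) (fun s t => hX.identDistrib _ _) (fun t => hX.memLp _)
    rwa [(hidabs _).variance_eq, (hidabs _).integral_eq] at this
  have hfin : ∀ᵐ ω ∂μ, ∑' j, ENNReal.ofReal |a j| * N j ω < ⊤ := by
    refine ae_lt_top (Measurable.tsum fun j => (hNmeas j).const_mul _) ?_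
    rw [lintegral_tsum fun j => ((hNmeas j).const_mul _).aemeasurable]
    simp only [lintegral_const_mul _ (hNmeas _)]
    refine ne_top_of_le_ne_top ?_ (ENNReal.tsum_le_tsum fun j =>
      mul_le_mul_right (hNle j) (ENNReal.ofReal |a j|))
    rw [ENNReal.tsum_mul_right, ← ENNReal.ofReal_tsum_of_nonneg (fun j => abs_nonneg _) hX.summable]
    exact ENNReal.mul_ne_top ENNReal.ofReal_ne_top ENNReal.ofReal_ne_top
  filter_upwards [ae_all_iff.2 hunc, ae_all_iff.2 hX.hasSum, hfin] with ω hω hsum hfinω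
  intro d hd φ
  -- Since 0 * ⊤ = 0 in `ENNReal`, finiteness of the sum says nothing about N j where a j = 0; there
  -- the majorant is trivial.
  have hNfin : ∀ j, a j ≠ 0 → N j ω ≠ ⊤ := by
    intro j hj h
    have h1 := ENNReal.le_tsum (f := fun j => ENNReal.ofReal |a j| * N j ω) j
    rw [h, ENNReal.mul_top (by simpa using hj)] at h1
    exact absurd (h1.trans_lt hfinω) (lt_irrefl _)
  set bound : ℤ → ℝ := fun j =>
    |a j| * (2 * (m₁ + 1)) + 2 * (ENNReal.ofReal |a j| * N j ω).toReal with hbound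
  have hbsum : Summable bound :=
    (hX.summable.mul_right _).add ((ENNReal.summable_toReal hfinω.ne).mul_left 2)
  have hdom : ∀ (n : ℕ) (j : ℤ), |a j| * avg n (fun t : ℕ => |e (t - j) ω|) ≤ bound j := by
    intro n j
    rcases eq_or_ne (a j) 0 with h0 | h0
    · simp [hbound, h0]
    have hk : ∀ k : ℕ, avg (2 ^ k) (fun t : ℕ => |e (t - j) ω|) ≤ m₁ + 1 + (N j ω).toReal := by
      intro k
      set A := avg (2 ^ k) (fun t : ℕ => |e (t - j) ω|) with hA
      have h1 : ‖A - m₁‖ₑ ^ 2 ≤ N j ω :=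
        ENNReal.le_tsum (f := fun k : ℕ =>
          ‖avg (2 ^ k) (fun t : ℕ => |e (t - j) ω|) - m₁‖ₑ ^ 2) k
      have h2 := ENNReal.toReal_mono (hNfin j h0) h1
      rw [ENNReal.toReal_pow, toReal_enorm, Real.norm_eq_abs, sq_abs] at h2
      -- This is x ≤ 1 + x² for x = A - m₁.
      nlinarith [sq_nonneg (A - m₁ - 1)]
    have h1 := avg_le_of_dyadic (fun t => abs_nonneg _) hk n
    have h2 : |a j| * avg n (fun t : ℕ => |e (t - j) ω|) ≤
        |a j| * (2 * (m₁ + 1 + (N j ω).toReal)) := by gcongr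
    refine h2.trans (le_of_eq ?_)
    simp only [hbound]
    rw [ENNReal.toReal_mul, ENNReal.toReal_ofReal (abs_nonneg _)]
    ring
  have hrep : ∀ n, avg n (fun t => (X t ω : ℂ) * wave d (φ n) t) =
      ∑' j : ℤ, (a j : ℂ) * avg n (fun t : ℕ => (e (t - j) ω : ℂ) * wave d (φ n) t) := by
    intro n
    refine (HasSum.tsum_eq ?_).symm
    have h1 : ∀ t : ℕ, HasSum (fun j : ℤ => (a j * e (t - j) ω : ℂ) * wave d (φ n) t)
        ((X t ω : ℂ) * wave d (φ n) t) := by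
      intro t
      have h2 : HasSum (fun j : ℤ => ((a j * e (t - j) ω : ℝ) : ℂ)) (X t ω : ℂ) :=
        Complex.hasSum_ofReal.2 (hsum t)
      simpa using h2.mul_right (wave d (φ n) t)
    have h3 := (hasSum_sum fun t (_ : t ∈ Finset.Icc 1 n) => h1 t).const_smul ((n : ℝ)⁻¹)
    refine h3.congr_fun ?_
    intro j
    rw [← avg_const_mul, avg]
    simp only [mul_assoc]
  -- Each shifted path is asymptotically uncorrelated with the waves, and the majorant does not
  -- depend on n or on the frequencies.
  have hlim := tendsto_tsum_of_dominated_convergence (𝓕 := atTop)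
    (f := fun (n : ℕ) (j : ℤ) =>
      (a j : ℂ) * avg n (fun t : ℕ => (e (t - j) ω : ℂ) * wave d (φ n) t))
    (g := fun _ => 0) hbsum
    (fun j => by simpa using ((hω j).tendsto_avg_mul_wave hd φ).const_mul (a j : ℂ))
    (Eventually.of_forall fun n j => by
      rw [norm_mul, Complex.norm_real, Real.norm_eq_abs]
      refine le_trans ?_ (hdom n j)
      gcongr
      refine (norm_avg_le _ _).trans (le_of_eq ?_)
      simp)
  rw [tsum_zero] at hlim
  exact hlim.congr fun n => (hrep n).symm

end LinearProcess

end ChirpLike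

theorem theorem8 {Ω : Type*} [MeasurableSpace Ω] (μ : Measure Ω) [IsProbabilityMeasure μ]
    {p q : ℕ} (M : ℝ) (θ₁ : Fin p → ChirpLike.Param) (θ₂ : Fin q → ChirpLike.Param)
    (e : ℤ → Ω → ℝ) (a : ℤ → ℝ) (σ : ℝ) (X : ℤ → Ω → ℝ)
    (hX : ChirpLike.IsLinearProcess μ e a σ X)
    (hθ₁ : ChirpLike.IsInteriorDistinct M θ₁) (hθ₂ : ChirpLike.IsInteriorDistinct M θ₂)
    (hpow₁ : ChirpLike.HasDecreasingPower θ₁) (hpow₂ : ChirpLike.HasDecreasingPower θ₂)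
    (hrates : ChirpLike.HasGenericRates θ₂)
    (S : Set ChirpLike.Param)
    (hS : S = ChirpLike.paramSpace M ∨ S = ChirpLike.freeAmplitudeSpace)
    (est₁ : ℕ → Ω → Fin p → ChirpLike.Param) (est₂ : ℕ → Ω → Fin q → ChirpLike.Param)
    (hest : ∀ᵐ ω ∂μ, ∀ᶠ n in atTop,
      ChirpLike.IsSequentialLSE S n (ChirpLike.signal θ₁ θ₂ X ω) (est₁ n ω) (est₂ n ω)) :
    (∀ j : Fin p, 1 ≤ (j : ℕ) →
      ∀ᵐ ω ∂μ, Tendsto (fun n => est₁ n ω j) atTop (𝓝 (θ₁ j))) ∧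
    (∀ k : Fin q, 1 ≤ (k : ℕ) →
      ∀ᵐ ω ∂μ, Tendsto (fun n => est₂ n ω k) atTop (𝓝 (θ₂ k))) := by
  have h : ∀ᵐ ω ∂μ, (∀ j, Tendsto (fun n => est₁ n ω j) atTop (𝓝 (θ₁ j))) ∧
      ∀ k, Tendsto (fun n => est₂ n ω k) atTop (𝓝 (θ₂ k)) := by
    filter_upwards [ChirpLike.ae_tendsto_avg_linearProcess hX, hest] with ω hx hω
    exact ChirpLike.tendsto_sequentialLSE hθ₁ hθ₂ hpow₁ hpow₂ hrates hS hx hω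
  exact ⟨fun j _ => h.mono fun ω hω => hω.1 j, fun k _ => h.mono fun ω hω => hω.2 k⟩
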